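/- Let $a<\sigma_0$ be real numbers and write $s=\sigma+i\tau$. Let $h$ be a meromorphic function on $\mathbb{C}$, real on the real axis (off its poles), with finitely many poles in $\mathbb{C}$, with finitely many zeros in $a\le\sigma<\sigma_0$, and holomorphic and non-vanishing on the line $\sigma=\sigma_0$. Put $$f(s)=f^{\pm}(s)=h(s)\pm h(2a-s),\qquad F(s)=\frac{h(2a-s)}{h(s)},$$ both regarded as meromorphic functions on $\mathbb{C}$ (removable singularities are removed). Suppose that (i) $F(s)\ne 1$ and $F(s)\neq -1$ for all $s$ with $\sigma=\sigma_0$, and there is $\tau_0>0$ such that $F$ is holomorphic at $s$ and $|F(s)|<1$ whenever $\sigma=\sigma_0$ and $|\tau|\ge\tau_0$; (ii) there are $K>0$ and a real sequence $(T_n)_{n\ge 1}$ with $T_n\to+\infty$ such that $F$ is holomorphic at $s$ and $|F(s)|<e^{K|s|}$ whenever $a\le\sigma\le\sigma_0$, $|\tau|=T_n$ and $n\ge1$. For $T>0$ let $N(T,\sigma_0)$ be the number of zeros of $f$ with $|\sigma-a|<\sigma_0-a$ and $0<\tau<T$, counted with multiplicity, and let $N_0'(T)$ be the number of distinct zeros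 of $f$ with $\sigma=a$ and $0<\tau<T$. Then, for either choice of the sign, these numbers are finite, and there is a constant $B$, independent of $T$, such that $$N(T,\sigma_0)-N_0'(T)\le B\qquad\text{for all } T>0.$$ Consequently all but finitely many of the zeros of $f$ in the strip $|\sigma-a|<\sigma_0-a$ lie on the line $\sigma=a$ and are simple. -/

import Mathlib

open Filter Topology

noncomputable section

/-! Meromorphic functions on the plane are represented by functions `ℂ → ℂ`; zeros, poles and
multiplicities are read off from `meromorphicOrderAt`, which ignores the values taken at isolated
points. -/

/-- The zeros of a meromorphic function: the points at which its order is positive. -/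
def zeroSet (f : ℂ → ℂ) : Set ℂ := {s | 0 < meromorphicOrderAt f s}

/-- The poles of a meromorphic function: the points at which its order is negative. -/
def poleSet (f : ℂ → ℂ) : Set ℂ := {s | meromorphicOrderAt f s < 0}

/-- The multiplicity of `s` as a zero of `f` (it is `0` where `f` has no zero). -/
def zeroMult (f : ℂ → ℂ) (s : ℂ) : ℕ := (meromorphicOrderAt f s).untop₀.toNat

/-- The function `f(s) = h(s) + ε h(2a - s)`, where `ε = 1` or `ε = -1`. -/
def reflSum (h : ℂ → ℂ) (a : ℝ) (ε : ℂ) : ℂ → ℂ := fun s => h s + ε * h (2 * a - s)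

/-- The meromorphic function `F(s) = h(2a - s) / h(s)`, with its removable singularities removed
(normal form of a meromorphic function). -/
def reflQuot (h : ℂ → ℂ) (a : ℝ) : ℂ → ℂ :=
  toMeromorphicNFOn (fun s => h (2 * a - s) / h s) Set.univ

/-- The zeros of `f` in the box `|σ - a| < σ₀ - a`, `0 < τ < T`. -/
def boxZeros (f : ℂ → ℂ) (a σ₀ T : ℝ) : Set ℂ :=
  {s | s ∈ zeroSet f ∧ |s.re - a| < σ₀ - a ∧ 0 < s.im ∧ s.im < T}

/-- `N(T, σ₀)`: the number of zeros of `f` with `|σ - a| < σ₀ - a`, `0 < τ < T`, counted with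
multiplicity. -/
def stripCount (f : ℂ → ℂ) (a σ₀ T : ℝ) : ℕ := ∑ᶠ s ∈ boxZeros f a σ₀ T, zeroMult f s

/-- `N₀'(T)`: the number of distinct zeros of `f` with `σ = a`, `0 < τ < T`. -/
def lineCount (f : ℂ → ℂ) (a T : ℝ) : ℕ :=
  {s | s ∈ zeroSet f ∧ s.re = a ∧ 0 < s.im ∧ s.im < T}.ncard

end

/-! Above some height in the strip, `h` has neither zeros nor poles, and a zero of `f` is a
solution, with the same multiplicity, of G = e, where G(s) = h(2a - s)/h(s) and e = -ε = ±1. Since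
`h` is real on the real axis, |G| = 1 on σ = a, while |G| < 1 on σ = σ₀. A Phragmén–Lindelöf
argument (`exists_norm_lt_of_half_strip`) shows that |G| is at most 1 + o(1) high up in the strip.

Call a solution of G = e exceptional if it lies strictly inside the half-strip, or if it lies on σ =
a with G' = 0. Near each exceptional point, and for every small u > 0, the equation G = e(1 + u) has
a solution strictly inside. In the interior this is the open mapping theorem; at a multiple solution
on σ = a, one of the m ≥ 2 branches leaves to the right
(`AnalyticAt.eventually_exists_re_gt_eq_mul_one_add`).

The function g = 1 - eG/(1 + u) has positive real part on the left, right and top sides of a tall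
rectangle. By the argument principle its zeros are therefore bounded by the number of real points of
G on the bottom side (`two_mul_card_zeros_le`). That number is finite and does not depend on u, so
there are finitely many exceptional points (`finite_exceptional_of_half_strip`). The symmetries of
`f` under conjugation and s ↦ 2a - s carry this over to the whole strip. -/

/-! ### Phragmén–Lindelöf in a half-strip. -/

/-- A Phragmén–Lindelöf principle in a vertical half-strip, with the growth of the function
controlled only on a sequence of horizontal segments. -/
theorem exists_norm_lt_of_half_strip {a σ₀ τ₁ K : ℝ} (ha : a < σ₀) {G : ℂ → ℂ}
    (hG : ∀ s : ℂ, a ≤ s.re → s.re ≤ σ₀ → τ₁ ≤ s.im → AnalyticAt ℂ G s)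
    (hleft : ∀ s : ℂ, s.re = a → τ₁ ≤ s.im → ‖G s‖ ≤ 1)
    (hright : ∀ s : ℂ, s.re = σ₀ → τ₁ ≤ s.im → ‖G s‖ ≤ 1)
    {t : ℕ → ℝ} (ht : Tendsto t atTop atTop)
    (hgrowth : ∀ n, ∀ s : ℂ, a ≤ s.re → s.re ≤ σ₀ → τ₁ ≤ s.im → s.im = t n →
      ‖G s‖ ≤ Real.exp (K * ‖s‖)) {μ : ℝ} (hμ : 1 < μ) :
    ∃ T₀ : ℝ, ∀ s : ℂ, a ≤ s.re → s.re ≤ σ₀ → τ₁ ≤ s.im → T₀ ≤ s.im → ‖G s‖ < μ := by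
  set W := σ₀ - a with hW
  have hWpos : 0 < W := sub_pos.2 ha
  -- With this frequency `c * (x - m)` stays within ±1/2 across the strip, so its cosine is bounded
  -- below by `k > 0`.
  set c : ℝ := W⁻¹ with hc
  have hcpos : 0 < c := inv_pos.2 hWpos
  set m : ℝ := (a + σ₀) / 2 with hm
  set k := Real.cos (1 / 2) with hk
  have hkpos : 0 < k := by
    apply Real.cos_pos_of_mem_Ioo
    constructor <;> linarith [Real.pi_gt_three]
  have hcos : ∀ x : ℝ, a ≤ x → x ≤ σ₀ → k ≤ Real.cos (c * (x - m)) := by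
    intro x h1 h2
    have hcW : c * W = 1 := inv_mul_cancel₀ hWpos.ne'
    rw [← Real.cos_abs (c * (x - m))]
    have habs : |c * (x - m)| ≤ 1 / 2 := by
      rw [abs_mul, abs_of_pos hcpos]
      have : |x - m| ≤ W / 2 := by rw [abs_le]; constructor <;> linarith
      nlinarith
    exact Real.cos_le_cos_of_nonneg_of_le_pi (abs_nonneg _) (by linarith [Real.pi_gt_three]) habs
  obtain ⟨M, hM⟩ : ∃ M : ℝ, ∀ s : ℂ, a ≤ s.re → s.re ≤ σ₀ → s.im = τ₁ → ‖G s‖ ≤ M := by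
    have hcomp : IsCompact (Set.Icc a σ₀ ×ℂ {τ₁}) := isCompact_Icc.reProdIm isCompact_singleton
    obtain ⟨M, hM⟩ := hcomp.exists_bound_of_continuousOn (f := G) (fun s hs => by
      rw [Complex.mem_reProdIm] at hs
      exact (hG s hs.1.1 hs.1.2 hs.2.ge).continuousAt.continuousWithinAt)
    exact ⟨M, fun s h1 h2 h3 => hM s (by rw [Complex.mem_reProdIm]; exact ⟨⟨h1, h2⟩, h3⟩)⟩
  -- Chosen so that `A * exp (-(c * τ₁)) * k = max M 0`: the damping then absorbs the bound on the
  -- bottom side through x ≤ exp x.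
  set A : ℝ := max M 0 * Real.exp (c * τ₁) / k with hA
  have hA0 : 0 ≤ A := by positivity
  -- The `A` term pays for the bottom side and decays upwards, which is why the final bound tends to
  -- 1. The `δ` term grows like `exp (c * s.im)`, so it beats `K * ‖s‖` on the segments at large
  -- heights `t n`; it disappears as δ → 0.
  set E : ℝ → ℂ → ℂ := fun δ s => Complex.exp (-(A * Complex.exp (Complex.I * c * (s - m)))
    - δ * Complex.exp (-Complex.I * c * (s - m))) with hE
  have hEnorm : ∀ δ s, ‖E δ s‖ = Real.exp (-(A * (Real.exp (-(c * s.im)) *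
      Real.cos (c * (s.re - m)))) - δ * (Real.exp (c * s.im) * Real.cos (c * (s.re - m)))) := by
    intro δ s
    rw [hE, Complex.norm_exp]
    congr 1
    simp [Complex.exp_re]
  have key : ∀ δ : ℝ, 0 < δ → ∀ s : ℂ, a ≤ s.re → s.re ≤ σ₀ → τ₁ ≤ s.im → ‖G s * E δ s‖ ≤ 1 := by
    intro δ hδ s h1 h2 h3
    have hlim : Tendsto (fun x : ℝ => δ * k * Real.exp (c * x) - |K| * (|a| + |σ₀| + |x|))
        atTop atTop := by
      have h4 : Tendsto (fun x : ℝ => δ * k * Real.exp (c * x) / x) atTop atTop := by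
        have := (Real.tendsto_exp_div_pow_atTop 1).comp
          (tendsto_id.const_mul_atTop hcpos : Tendsto (fun x : ℝ => c * x) atTop atTop)
        refine (this.const_mul_atTop (show 0 < δ * k * c by positivity)).congr' ?_
        filter_upwards [eventually_gt_atTop 0] with x hx
        simp only [Function.comp, pow_one]
        field_simp
      refine tendsto_atTop_mono' atTop ?_ tendsto_id
      filter_upwards [h4.eventually_ge_atTop (|K| * (|a| + |σ₀|) + |K| + 1),
        eventually_ge_atTop 1] with x hx hx1
      rw [le_div_iff₀ (by linarith)] at hx
      rw [abs_of_nonneg (show 0 ≤ x by linarith)]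
      have h5 : 0 ≤ |K| * (|a| + |σ₀|) := by positivity
      simp only [id]
      nlinarith
    obtain ⟨n, hn1, hn2, hn3⟩ := (((hlim.comp ht).eventually_ge_atTop 0).and
      ((ht.eventually_gt_atTop τ₁).and (ht.eventually_ge_atTop s.im))).exists
    simp only [Function.comp, sub_nonneg] at hn1
    set R := Set.Ioo a σ₀ ×ℂ Set.Ioo τ₁ (t n) with hR
    have hclos : closure R = Set.Icc a σ₀ ×ℂ Set.Icc τ₁ (t n) := by
      rw [hR, Complex.closure_reProdIm, closure_Ioo ha.ne, closure_Ioo hn2.ne]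
    refine Complex.norm_le_of_forall_mem_frontier_norm_le (U := R)
      (f := fun s => G s * E δ s) ?_ ?_ ?_ ?_
    · exact (Metric.isBounded_Ioo _ _).reProdIm (Metric.isBounded_Ioo _ _)
    · apply DifferentiableOn.diffContOnCl
      rw [hclos]
      intro z hz
      rw [Complex.mem_reProdIm] at hz
      refine DifferentiableAt.differentiableWithinAt ?_
      refine (hG z hz.1.1 hz.1.2 hz.2.1).differentiableAt.mul ?_
      simp only [hE]
      fun_prop
    · intro z hz
      rw [hR, Complex.frontier_reProdIm, closure_Ioo ha.ne, closure_Ioo hn2.ne,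
        frontier_Ioo ha, frontier_Ioo hn2] at hz
      have hz' : (a ≤ z.re ∧ z.re ≤ σ₀) ∧ (τ₁ ≤ z.im ∧ z.im ≤ t n) ∧
          (z.re = a ∨ z.re = σ₀ ∨ z.im = τ₁ ∨ z.im = t n) := by
        simp only [Set.mem_union, Complex.mem_reProdIm, Set.mem_Icc, Set.mem_insert_iff,
          Set.mem_singleton_iff] at hz
        rcases hz with ⟨h, h' | h'⟩ | ⟨h' | h', h⟩ <;>
          simp [h, h', ha.le, hn2.le]
      obtain ⟨⟨z1, z2⟩, ⟨z3, z4⟩, h4⟩ := hz'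
      have hkz := hcos z.re z1 z2
      rw [norm_mul, hEnorm]
      have e1 := Real.exp_pos (-(c * z.im))
      have e2 := Real.exp_pos (c * z.im)
      have p1 : 0 ≤ A * (Real.exp (-(c * z.im)) * Real.cos (c * (z.re - m))) := by
        have := hkpos.le.trans hkz
        positivity
      have p2 : 0 ≤ δ * (Real.exp (c * z.im) * Real.cos (c * (z.re - m))) := by
        have := hkpos.le.trans hkz
        positivity
      have side : ‖G z‖ ≤ 1 → ‖G z‖ * Real.exp (-(A * (Real.exp (-(c * z.im)) *
          Real.cos (c * (z.re - m)))) - δ * (Real.exp (c * z.im) *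
          Real.cos (c * (z.re - m)))) ≤ 1 := fun h =>
        mul_le_one₀ h (Real.exp_pos _).le (Real.exp_le_one_iff.2 (by linarith))
      rcases h4 with h4 | h4 | h4 | h4
      · exact side (hleft z h4 z3)
      · exact side (hright z h4 z3)
      · have hb : ‖G z‖ ≤ max M 0 := (hM z z1 z2 h4).trans (le_max_left _ _)
        have h6 : max M 0 ≤ A * (Real.exp (-(c * z.im)) * Real.cos (c * (z.re - m))) := by
          calc max M 0 = A * (Real.exp (-(c * z.im)) * k) := by
                rw [hA, h4, Real.exp_neg]; field_simp
            _ ≤ _ := by gcongr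
        have h7 : ‖G z‖ ≤ Real.exp (A * (Real.exp (-(c * z.im)) * Real.cos (c * (z.re - m)))) := by
          linarith [Real.add_one_le_exp (A * (Real.exp (-(c * z.im)) *
            Real.cos (c * (z.re - m))))]
        calc _ ≤ _ := mul_le_mul_of_nonneg_right h7 (Real.exp_pos _).le
          _ ≤ 1 := by rw [← Real.exp_add]; exact Real.exp_le_one_iff.2 (by linarith)
      · have h7 := hgrowth n z z1 z2 z3 h4
        have h8 : ‖z‖ ≤ |a| + |σ₀| + |t n| := by
          refine (Complex.norm_le_abs_re_add_abs_im z).trans ?_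
          rw [h4]
          gcongr
          rw [abs_le]
          constructor
          · linarith [neg_abs_le a, abs_nonneg σ₀]
          · linarith [le_abs_self σ₀, abs_nonneg a]
        have h9 : K * ‖z‖ ≤ |K| * (|a| + |σ₀| + |t n|) :=
          mul_le_mul (le_abs_self K) h8 (norm_nonneg _) (abs_nonneg _)
        have h10 : δ * k * Real.exp (c * t n) ≤
            δ * (Real.exp (c * z.im) * Real.cos (c * (z.re - m))) := by
          rw [h4, mul_assoc, mul_comm k]; gcongr
        calc _ ≤ _ := mul_le_mul_of_nonneg_right h7 (Real.exp_pos _).le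
          _ ≤ 1 := by rw [← Real.exp_add]; exact Real.exp_le_one_iff.2 (by linarith)
    · rw [hclos, Complex.mem_reProdIm]
      exact ⟨⟨h1, h2⟩, h3, hn3⟩
  have bound : ∀ s : ℂ, a ≤ s.re → s.re ≤ σ₀ → τ₁ ≤ s.im →
      ‖G s‖ ≤ Real.exp (A * Real.exp (-(c * s.im))) := by
    intro s h1 h2 h3
    have hE0 : Tendsto (fun δ : ℝ => ‖G s * E δ s‖) (𝓝[>] 0) (𝓝 ‖G s * E 0 s‖) := by
      have : Continuous fun δ : ℝ => ‖G s * E δ s‖ := by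
        simp only [hE]; fun_prop
      exact (this.tendsto 0).mono_left nhdsWithin_le_nhds
    have h4 : ‖G s * E 0 s‖ ≤ 1 := le_of_tendsto hE0 (by
      filter_upwards [self_mem_nhdsWithin] with δ hδ using key δ hδ s h1 h2 h3)
    rw [norm_mul, hEnorm, zero_mul, sub_zero, Real.exp_neg, ← div_eq_mul_inv,
      div_le_one (Real.exp_pos _)] at h4
    refine h4.trans (Real.exp_le_exp.2 ?_)
    gcongr
    exact mul_le_of_le_one_right (Real.exp_pos _).le (Real.cos_le_one _)
  have hlim : Tendsto (fun y : ℝ => Real.exp (A * Real.exp (-(c * y)))) atTop (𝓝 1) := by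
    have h1 : Tendsto (fun y : ℝ => c * y) atTop atTop := tendsto_id.const_mul_atTop hcpos
    have h2 := (Real.tendsto_exp_neg_atTop_nhds_zero.comp h1).const_mul A
    rw [mul_zero] at h2
    have h3 := (Real.continuous_exp.tendsto 0).comp h2
    rwa [Real.exp_zero] at h3
  obtain ⟨T₀, hT₀⟩ := (hlim.eventually_lt_const hμ).exists_forall_of_atTop
  exact ⟨T₀, fun s h1 h2 h3 h4 => (bound s h1 h2 h3).trans_lt (hT₀ _ h4)⟩

/-! ### Factorisation, logarithms and branches of the argument on a rectangle. -/

theorem Convex.isPreconnected_reProdIm {s t : Set ℝ} (hs : Convex ℝ s) (ht : Convex ℝ t) :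
    IsPreconnected (s ×ℂ t) :=
  ((hs.linear_preimage Complex.reLm).inter (ht.linear_preimage Complex.imLm)).isPreconnected

/-- An analytic function on a compact connected set, not identically zero there, is the product of
a polynomial carrying its zeros and of a zero-free function. -/
theorem AnalyticOnNhd.exists_eq_prod_mul {R : Set ℂ} (hcomp : IsCompact R)
    (hconn : IsPreconnected R) (hnt : R.Nontrivial) {g : ℂ → ℂ} (hg : AnalyticOnNhd ℂ g R)
    {z₀ : ℂ} (hz₀ : z₀ ∈ R) (hgz₀ : g z₀ ≠ 0) :
    ∃ (P : Finset ℂ) (d : ℂ → ℕ) (q : ℂ → ℂ), (∀ u ∈ P, u ∈ R ∧ g u = 0 ∧ 1 ≤ d u) ∧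
      (∀ u ∈ R, g u = 0 → u ∈ P) ∧ ContinuousOn q R ∧ (∀ s ∈ R, q s ≠ 0) ∧
      ∀ s ∈ R, g s = (∏ u ∈ P, (s - u) ^ d u) * q s := by
  have hmer : MeromorphicOn g R := hg.meromorphicOn
  have htop : ∀ u ∈ R, meromorphicOrderAt g u ≠ ⊤ := by
    intro u hu
    refine hmer.meromorphicOrderAt_ne_top_of_isPreconnected hconn hz₀ hu ?_
    rw [(hg z₀ hz₀).meromorphicOrderAt_eq, (hg z₀ hz₀).analyticOrderAt_eq_zero.2 hgz₀]
    simp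
  set D := MeromorphicOn.divisor g R with hD
  have hfin : D.support.Finite := D.finiteSupport hcomp
  have hD0 : ∀ u, 0 ≤ D u := MeromorphicOn.AnalyticOnNhd.divisor_nonneg hg
  have hiff : ∀ u ∈ R, D u ≠ 0 ↔ g u = 0 := by
    intro u hu
    have h1 := htop u hu
    rw [hD, MeromorphicOn.divisor_apply hmer hu, ← not_iff_not, not_not, ← Ne,
      ← (hg u hu).analyticOrderAt_eq_zero]
    rw [(hg u hu).meromorphicOrderAt_eq] at h1 ⊢
    cases h : analyticOrderAt g u with
    | top => simp [h] at h1
    | coe n => simp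
  obtain ⟨q, hq, hq0, hgq⟩ := hmer.extract_zeros_poles (fun u => htop u u.2) hfin
  have hprod : ∀ s, (∏ᶠ u, (· - u) ^ D u : ℂ → ℂ) s
      = ∏ u ∈ hfin.toFinset, (s - u) ^ (D u).toNat := by
    intro s
    rw [Function.FactorizedRational.finprod_eq_fun hfin]
    beta_reduce
    rw [finprod_eq_prod_of_mulSupport_subset (s := hfin.toFinset)]
    · refine Finset.prod_congr rfl fun u _ => ?_
      rw [← zpow_natCast, Int.toNat_of_nonneg (hD0 u)]
    · intro u hu
      simp only [Function.mem_mulSupport] at hu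
      simp only [Set.Finite.coe_toFinset, Function.mem_support]
      intro h
      exact hu (by simp [h])
  refine ⟨hfin.toFinset, fun u => (D u).toNat, q, ?_, ?_, ?_, fun s hs => hq0 ⟨s, hs⟩, ?_⟩
  · intro u hu
    rw [Set.Finite.mem_toFinset] at hu
    have huR := D.supportWithinDomain hu
    refine ⟨huR, (hiff u huR).1 hu, ?_⟩
    have : D u ≠ 0 := hu
    have := hD0 u
    change 1 ≤ (D u).toNat
    omega
  · intro u hu h
    rw [Set.Finite.mem_toFinset]
    exact (hiff u hu).2 h
  · exact hq.continuousOn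
  · intro s hs
    set p : ℂ → ℂ := fun s => (∏ u ∈ hfin.toFinset, (s - u) ^ (D u).toNat) * q s with hp
    have hpa : AnalyticAt ℂ p s := by
      refine AnalyticAt.mul ?_ (hq s hs)
      exact Finset.analyticAt_fun_prod _ fun u _ => by fun_prop
    -- The factorisation is known only off a discrete set; since `R` has no isolated points and both
    -- sides are analytic, it holds at every point of `R`.
    have h1 : g =ᶠ[codiscreteWithin R] p := by
      filter_upwards [hgq] with z hz
      rw [hz, Pi.smul_apply', hprod, smul_eq_mul]
    have h2 := (hmer s hs).eventuallyEq_nhdsNE_of_eventuallyEq_codiscreteWithin_preperfect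
      hpa.meromorphicAt hs (hconn.preperfect_of_nontrivial hnt) h1
    exact (((hg s hs).continuousAt.eventuallyEq_nhds_iff_eventuallyEq_nhdsNE
      hpa.continuousAt).1 h2).eq_of_nhds

/-- A continuous zero-free function on a closed rectangle has a continuous logarithm. -/
theorem exists_continuousOn_log_rect {a b c d : ℝ} (hab : a ≤ b) (hcd : c ≤ d) {q : ℂ → ℂ}
    (hq : ContinuousOn q (Set.Icc a b ×ℂ Set.Icc c d))
    (hq0 : ∀ s ∈ Set.Icc a b ×ℂ Set.Icc c d, q s ≠ 0) :
    ∃ l : ℂ → ℂ, Continuous l ∧ ∀ s ∈ Set.Icc a b ×ℂ Set.Icc c d, Complex.exp (l s) = q s := by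
  -- The retraction of the plane onto the rectangle: `q ∘ r` is continuous and zero-free on a simply
  -- connected open set.
  set r : ℂ → ℂ := fun s => (max a (min b s.re) : ℝ) + (max c (min d s.im) : ℝ) * Complex.I
    with hr
  have hrc : Continuous r := by
    rw [hr]
    fun_prop
  have hrR : ∀ s, r s ∈ Set.Icc a b ×ℂ Set.Icc c d := by
    intro s
    rw [Complex.mem_reProdIm]
    simp [hr, hab, hcd]
  have hreq : ∀ s ∈ Set.Icc a b ×ℂ Set.Icc c d, r s = s := by
    intro s hs
    rw [Complex.mem_reProdIm] at hs
    apply Complex.ext <;> simp [hr, hs.1.1, hs.1.2, hs.2.1, hs.2.2]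
  have huniv : IsSimplyConnected (Set.univ : Set ℂ) := by
    have : ContractibleSpace (Set.univ : Set ℂ) :=
      (Homeomorph.Set.univ ℂ).contractibleSpace
    exact (inferInstance : SimplyConnectedSpace (Set.univ : Set ℂ))
  obtain ⟨l, hl, hle⟩ := Complex.exists_continuousOn_eqOn_exp_comp huniv isOpen_univ
    (g := q ∘ r) (hq.comp_continuous hrc hrR).continuousOn
    (by rintro ⟨s, -, hs⟩; exact hq0 _ (hrR s) hs)
  refine ⟨l, continuousOn_univ.1 hl, fun s hs => ?_⟩
  have := hle (Set.mem_univ s)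
  simpa [hreq s hs] using this

/-- The branch of the argument with its cut along the negative imaginary axis. -/
noncomputable def argCutDown (w : ℂ) : ℝ := (-Complex.I * w).arg + Real.pi / 2

/-- The branch of the argument with its cut along the positive imaginary axis. -/
noncomputable def argCutUp (w : ℂ) : ℝ := (Complex.I * w).arg - Real.pi / 2

theorem norm_mul_exp_argCutDown (w : ℂ) :
    (‖w‖ : ℂ) * Complex.exp (argCutDown w * Complex.I) = w := by
  have h := Complex.norm_mul_exp_arg_mul_I (-Complex.I * w)
  rw [norm_mul, norm_neg, Complex.norm_I, one_mul] at h
  rw [argCutDown]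
  push_cast
  rw [add_mul, Complex.exp_add, ← mul_assoc, h, Complex.exp_pi_div_two_mul_I]
  linear_combination (-w) * Complex.I_mul_I

theorem norm_mul_exp_argCutUp (w : ℂ) :
    (‖w‖ : ℂ) * Complex.exp (argCutUp w * Complex.I) = w := by
  have h := Complex.norm_mul_exp_arg_mul_I (Complex.I * w)
  rw [norm_mul, Complex.norm_I, one_mul] at h
  rw [argCutUp]
  push_cast
  rw [sub_mul, Complex.exp_sub, mul_div_assoc', h, Complex.exp_pi_div_two_mul_I]
  field_simp

theorem continuousAt_argCutDown {w : ℂ} (h : 0 < w.im ∨ w.re ≠ 0) :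
    ContinuousAt argCutDown w := by
  have h1 : ContinuousAt Complex.arg (-Complex.I * w) := by
    apply Complex.continuousAt_arg
    rw [Complex.mem_slitPlane_iff]
    simpa using h
  exact (ContinuousAt.comp (f := fun w => -Complex.I * w) h1 (by fun_prop)).add continuousAt_const

theorem continuousAt_argCutUp {w : ℂ} (h : w.im < 0) : ContinuousAt argCutUp w := by
  have h1 : ContinuousAt Complex.arg (Complex.I * w) := by
    apply Complex.continuousAt_arg
    rw [Complex.mem_slitPlane_iff]
    simp [h]
  exact (ContinuousAt.comp (f := fun w => Complex.I * w) h1 (by fun_prop)).sub continuousAt_const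

theorem argCutDown_eq_argCutUp {w : ℂ} (h : 0 < w.re) : argCutDown w = argCutUp w := by
  have := Complex.arg_neg_eq_arg_sub_pi_of_im_pos (x := Complex.I * w) (by simpa using h)
  rw [argCutDown, argCutUp, neg_mul, this]
  ring

/-- This jump, present to the left of a zero and absent to its right, is what makes each zero
contribute 2π in the argument principle below. -/
theorem argCutDown_eq_argCutUp_add {w : ℂ} (h : w.re < 0) :
    argCutDown w = argCutUp w + 2 * Real.pi := by
  have := Complex.arg_neg_eq_arg_add_pi_of_im_neg (x := Complex.I * w) (by simpa using h)
  rw [argCutDown, argCutUp, neg_mul, this]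
  ring

/-- A continuous determination of the argument of a function with values in the right half-plane
differs from the principal one by a constant. -/
theorem IsPreconnected.sub_arg_eq {U : Set ℂ} (hU : IsPreconnected U) {g : ℂ → ℂ} {θ : ℂ → ℝ}
    (hg : ContinuousOn g U) (hre : ∀ s ∈ U, 0 < (g s).re) (hθ : ContinuousOn θ U)
    (hgθ : ∀ s ∈ U, (‖g s‖ : ℂ) * Complex.exp (θ s * Complex.I) = g s) {x y : ℂ} (hx : x ∈ U)
    (hy : y ∈ U) : θ x - (g x).arg = θ y - (g y).arg := by
  have hdisc : IsDiscrete (AddSubgroup.zmultiples (2 * Real.pi) : Set ℝ) :=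
    ⟨(inferInstance : DiscreteTopology (AddSubgroup.zmultiples (2 * Real.pi)))⟩
  -- Two arguments of the same nonzero number differ by an element of 2πℤ, which is discrete.
  refine hU.constant_of_mapsTo hdisc (f := fun s => θ s - (g s).arg) ?_ ?_ hx hy
  · refine hθ.sub fun s hs => ?_
    exact (Complex.continuousAt_arg (Or.inl (hre s hs))).comp_continuousWithinAt (hg s hs)
  · intro s hs
    have h0 : g s ≠ 0 := by
      intro h
      simpa [h] using hre s hs
    have h1 := (hgθ s hs).trans (Complex.norm_mul_exp_arg_mul_I (g s)).symm
    have h2 := mul_left_cancel₀ (by simpa using h0) h1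
    obtain ⟨n, hn⟩ := Complex.exp_eq_exp_iff_exists_int.1 h2
    have h3 : (θ s : ℂ) = (g s).arg + n * (2 * Real.pi) := by
      apply mul_right_cancel₀ Complex.I_ne_zero
      rw [hn]; ring
    have h4 : θ s = (g s).arg + n * (2 * Real.pi) := by exact_mod_cast h3
    rw [SetLike.mem_coe, AddSubgroup.mem_zmultiples_iff]
    refine ⟨n, ?_⟩
    simp only [zsmul_eq_mul]
    linarith

/-! ### Counting zeros in a rectangle by the argument principle. -/

/-- A continuous function whose increment exceeds `n * π` takes at least `n` values in `π * ℤ`. -/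
theorem le_card_of_increment_gt {a b : ℝ} (hab : a ≤ b) {θ : ℝ → ℝ}
    (hθ : ContinuousOn θ (Set.Icc a b)) {n : ℕ} (hn : θ a + n * Real.pi < θ b) {S : Finset ℝ}
    (hS : ∀ x ∈ Set.Icc a b, (∃ j : ℤ, θ x = j * Real.pi) → x ∈ S) : n ≤ S.card := by
  have hpi := Real.pi_pos
  set j₀ := ⌊θ a / Real.pi⌋ with hj
  have hj1 : j₀ * Real.pi ≤ θ a := (le_div_iff₀ hpi).1 (Int.floor_le _)
  have hj2 : θ a < (j₀ + 1) * Real.pi := (div_lt_iff₀ hpi).1 (Int.lt_floor_add_one _)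
  -- The multiples (j₀ + 1)π, …, (j₀ + n)π all lie between `θ a` and `θ b`.
  have hex : ∀ i : Fin n, ∃ x ∈ Set.Icc a b, θ x = (j₀ + 1 + (i : ℕ)) * Real.pi := by
    intro i
    have hi : ((i : ℕ) : ℝ) + 1 ≤ n := by exact_mod_cast i.2
    have hi0 : (0 : ℝ) ≤ (i : ℕ) := Nat.cast_nonneg _
    obtain ⟨x, hx, hxe⟩ := intermediate_value_Icc hab hθ
      (show (j₀ + 1 + (i : ℕ)) * Real.pi ∈ Set.Icc (θ a) (θ b) by constructor <;> nlinarith)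
    exact ⟨x, hx, hxe⟩
  choose x hx hxe using hex
  have hinj : Function.Injective x := by
    intro i i' h
    have h1 := hxe i
    rw [h, hxe i'] at h1
    have h2 := mul_right_cancel₀ hpi.ne' h1
    have h3 : ((i' : ℕ) : ℝ) = (i : ℕ) := by linarith
    exact Fin.ext (by exact_mod_cast h3.symm)
  calc n = (Finset.univ.image x).card := by
        rw [Finset.card_image_of_injective _ hinj, Finset.card_univ, Fintype.card_fin]
    _ ≤ S.card := by
        apply Finset.card_le_card
        intro y hy
        obtain ⟨i, -, rfl⟩ := Finset.mem_image.1 hy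
        refine hS _ (hx i) ⟨j₀ + 1 + (i : ℕ), ?_⟩
        rw [hxe i]
        push_cast
        ring

/-- If the real part of an analytic function is positive on three sides of a rectangle, the zeros
inside are controlled by the points of the fourth side where the imaginary part vanishes. -/
theorem two_mul_card_zeros_le {a b c d : ℝ} (hab : a < b) (hcd : c < d) {g : ℂ → ℂ}
    (hg : AnalyticOnNhd ℂ g (Set.Icc a b ×ℂ Set.Icc c d))
    (hleft : ∀ s : ℂ, s.re = a → c ≤ s.im → s.im ≤ d → 0 < (g s).re)
    (hright : ∀ s : ℂ, s.re = b → c ≤ s.im → s.im ≤ d → 0 < (g s).re)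
    (htop : ∀ s : ℂ, a ≤ s.re → s.re ≤ b → s.im = d → 0 < (g s).re)
    (hbot : ∀ s : ℂ, a ≤ s.re → s.re ≤ b → s.im = c → g s ≠ 0)
    {Z : Finset ℂ} (hZ : ∀ z ∈ Z, z ∈ Set.Icc a b ×ℂ Set.Icc c d ∧ g z = 0)
    {S : Finset ℝ} (hS : ∀ x ∈ Set.Icc a b, (g (x + c * Complex.I)).im = 0 → x ∈ S) :
    2 * Z.card ≤ S.card + 1 := by
  set R : Set ℂ := Set.Icc a b ×ℂ Set.Icc c d with hR
  have memR : ∀ s : ℂ, s ∈ R ↔ (a ≤ s.re ∧ s.re ≤ b) ∧ (c ≤ s.im ∧ s.im ≤ d) := by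
    intro s
    rw [hR, Complex.mem_reProdIm, Set.mem_Icc, Set.mem_Icc]
  have hne : ∀ s, 0 < (g s).re → g s ≠ 0 := by
    intro s hs h
    simp [h] at hs
  set BL : ℂ := a + c * Complex.I with hBL
  set BR : ℂ := b + c * Complex.I with hBR
  have hBLre : BL.re = a := by simp [hBL]
  have hBLim : BL.im = c := by simp [hBL]
  have hBRre : BR.re = b := by simp [hBR]
  have hBRim : BR.im = c := by simp [hBR]
  have hBLR : BL ∈ R := by rw [memR]; simp [hBLre, hBLim, hab.le, hcd.le]
  have hBRR : BR ∈ R := by rw [memR]; simp [hBRre, hBRim, hab.le, hcd.le]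
  have hconn : IsPreconnected R :=
    (convex_Icc a b).isPreconnected_reProdIm (convex_Icc c d)
  obtain ⟨P, m, q, hP, hPmem, hqc, hq0, hgq⟩ := hg.exists_eq_prod_mul
    (isCompact_Icc.reProdIm isCompact_Icc) hconn
    ⟨BL, hBLR, BR, hBRR, fun h => hab.ne (by rw [← hBLre, h, hBRre])⟩ hBLR
    (hne _ (hleft _ hBLre hBLim.ge (hBLim.le.trans hcd.le)))
  obtain ⟨l, hl, hle⟩ := exists_continuousOn_log_rect hab.le hcd.le hqc hq0
  have hPint : ∀ u ∈ P, (a < u.re ∧ u.re < b) ∧ (c < u.im ∧ u.im < d) := by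
    intro u hu
    obtain ⟨huR, hgu, -⟩ := hP u hu
    obtain ⟨⟨h1, h2⟩, h3, h4⟩ := (memR u).1 huR
    refine ⟨⟨lt_of_le_of_ne h1 ?_, lt_of_le_of_ne h2 ?_⟩, lt_of_le_of_ne h3 ?_,
      lt_of_le_of_ne h4 ?_⟩
    · exact fun h => hne _ (hleft u h.symm h3 h4) hgu
    · exact fun h => hne _ (hright u h h3 h4) hgu
    · exact fun h => hbot u h1 h2 h.symm hgu
    · exact fun h => hne _ (htop u h1 h2 h) hgu
  -- Two arguments of `g`. With the cuts running down from the zeros, `θ₁` is continuous on the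
  -- left, top and right sides; with the cuts running up, `θ₂` is continuous on the bottom side.
  set θ₁ : ℂ → ℝ := fun s => (∑ u ∈ P, m u * argCutDown (s - u)) + (l s).im with hθ₁
  set θ₂ : ℂ → ℝ := fun s => (∑ u ∈ P, m u * argCutUp (s - u)) + (l s).im with hθ₂
  have polar : ∀ (A : ℂ → ℝ), (∀ w, (‖w‖ : ℂ) * Complex.exp (A w * Complex.I) = w) → ∀ s ∈ R,
      (‖g s‖ : ℂ) * Complex.exp (((∑ u ∈ P, m u * A (s - u)) + (l s).im : ℝ) * Complex.I)
        = g s := by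
    intro A hA s hs
    rw [hgq s hs, norm_mul, norm_prod]
    push_cast
    rw [add_mul, Complex.exp_add, Finset.sum_mul, Complex.exp_sum]
    rw [mul_mul_mul_comm, ← Finset.prod_mul_distrib]
    congr 1
    · refine Finset.prod_congr rfl fun u _ => ?_
      rw [norm_pow, mul_assoc, Complex.exp_nat_mul, Complex.ofReal_pow, ← mul_pow, hA]
    · rw [← hle s hs, Complex.norm_exp, Complex.ofReal_exp, ← Complex.exp_add,
        Complex.re_add_im]
  have hθ₁c : ∀ s, (∀ u ∈ P, 0 < (s - u).im ∨ (s - u).re ≠ 0) → ContinuousAt θ₁ s := by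
    intro s hs
    refine ContinuousAt.add (tendsto_finsetSum _ fun u hu => ?_) (by fun_prop)
    exact continuousAt_const.mul (ContinuousAt.comp (f := fun s => s - u)
      (continuousAt_argCutDown (hs u hu)) (by fun_prop))
  have hθ₂c : ∀ s, s.im = c → ContinuousAt θ₂ s := by
    intro s hs
    refine ContinuousAt.add (tendsto_finsetSum _ fun u hu => ?_) (by fun_prop)
    refine continuousAt_const.mul (ContinuousAt.comp (f := fun s => s - u)
      (continuousAt_argCutUp ?_) (by fun_prop))
    rw [Complex.sub_im, hs]
    linarith [(hPint u hu).2.1]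
  set U : Set ℂ := ({a} ×ℂ Set.Icc c d) ∪ (Set.Icc a b ×ℂ {d}) ∪ ({b} ×ℂ Set.Icc c d) with hU
  have hUconn : IsPreconnected U := by
    have h1 : IsPreconnected (({a} : Set ℝ) ×ℂ Set.Icc c d) :=
      (convex_singleton a).isPreconnected_reProdIm (convex_Icc c d)
    have h2 : IsPreconnected (Set.Icc a b ×ℂ ({d} : Set ℝ)) :=
      (convex_Icc a b).isPreconnected_reProdIm (convex_singleton d)
    have h3 : IsPreconnected (({b} : Set ℝ) ×ℂ Set.Icc c d) :=
      (convex_singleton b).isPreconnected_reProdIm (convex_Icc c d)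
    refine (h1.union (a + d * Complex.I) ?_ ?_ h2).union (b + d * Complex.I) (Or.inr ?_) ?_ h3 <;>
      simp [Complex.mem_reProdIm, hab.le, hcd.le]
  have hUmem : ∀ s ∈ U, s ∈ R ∧ (s.re = a ∨ s.re = b ∨ s.im = d) := by
    rintro s ((h | h) | h) <;> rw [Complex.mem_reProdIm] at h <;> rw [memR] <;>
      obtain ⟨h1, h2⟩ := h <;>
      simp only [Set.mem_Icc, Set.mem_singleton_iff] at h1 h2 <;> simp [h1, h2, hab.le, hcd.le]
  have hUre : ∀ s ∈ U, 0 < (g s).re := by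
    intro s hs
    obtain ⟨h1, h | h | h⟩ := hUmem s hs <;> rw [memR] at h1
    · exact hleft s h h1.2.1 h1.2.2
    · exact hright s h h1.2.1 h1.2.2
    · exact htop s h1.1.1 h1.1.2 h
  -- On the three sides `g` stays in the right half-plane, so `θ₁` changes by less than π from `BL`
  -- to `BR`.
  have hconst := hUconn.sub_arg_eq (g := g) (θ := θ₁) (x := BL) (y := BR)
    (fun s hs => (hg s (hUmem s hs).1).continuousAt.continuousWithinAt) hUre
    (fun s hs => (hθ₁c s fun u hu => by
      obtain ⟨⟨h1, h2⟩, h3, h4⟩ := hPint u hu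
      rw [Complex.sub_re, Complex.sub_im]
      obtain ⟨-, h | h | h⟩ := hUmem s hs <;> rw [h]
      · exact Or.inr (by linarith)
      · exact Or.inr (by linarith)
      · exact Or.inl (by linarith)).continuousWithinAt)
    (fun s hs => polar argCutDown norm_mul_exp_argCutDown s (hUmem s hs).1)
    (by left; left; simp [Complex.mem_reProdIm, hBLre, hBLim, hcd.le])
    (by right; simp [Complex.mem_reProdIm, hBRre, hBRim, hcd.le])
  have hL : θ₁ BL = θ₂ BL + (∑ u ∈ P, m u : ℕ) * (2 * Real.pi) := by
    simp only [hθ₁, hθ₂]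
    push_cast
    rw [add_right_comm, Finset.sum_mul, ← Finset.sum_add_distrib]
    congr 1
    refine Finset.sum_congr rfl fun u hu => ?_
    rw [argCutDown_eq_argCutUp_add (by rw [Complex.sub_re, hBLre]; linarith [(hPint u hu).1.1])]
    ring
  have hRt : θ₁ BR = θ₂ BR := by
    simp only [hθ₁, hθ₂]
    congr 1
    refine Finset.sum_congr rfl fun u hu => ?_
    rw [argCutDown_eq_argCutUp (by rw [Complex.sub_re, hBRre]; linarith [(hPint u hu).1.2])]
  have hargL := abs_lt.1 (Complex.abs_arg_lt_pi_div_two_iff.2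
    (Or.inl (hleft _ hBLre hBLim.ge (hBLim.le.trans hcd.le))))
  have hargR := abs_lt.1 (Complex.abs_arg_lt_pi_div_two_iff.2
    (Or.inl (hright _ hBRre hBRim.ge (hBRim.le.trans hcd.le))))
  have hZcard : Z.card ≤ ∑ u ∈ P, m u := by
    calc Z.card ≤ P.card := Finset.card_le_card fun z hz => hPmem z (hZ z hz).1 (hZ z hz).2
      _ = ∑ u ∈ P, 1 := by simp
      _ ≤ ∑ u ∈ P, m u := Finset.sum_le_sum fun u hu => (hP u hu).2.2
  set M := ∑ u ∈ P, m u with hM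
  -- The case `M = 0` is split off because `2 * M - 1` below is a truncated subtraction.
  rcases Nat.eq_zero_or_pos M with hM0 | hM0
  · omega
  have hpath : ∀ x : ℝ, (x + c * Complex.I : ℂ).re = x ∧ (x + c * Complex.I : ℂ).im = c := by
    intro x
    simp
  -- Along the bottom `θ₂` gains 2πM plus the change of `θ₁`, hence more than (2M - 1)π; wherever
  -- `θ₂` is a multiple of π, `g` is real.
  have := le_card_of_increment_gt hab.le (θ := fun x => θ₂ (x + c * Complex.I)) (n := 2 * M - 1)
    (S := S) ?_ ?_ ?_
  · omega
  · intro x _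
    exact (ContinuousAt.comp (f := fun x : ℝ => (x + c * Complex.I : ℂ)) (hθ₂c _ (hpath x).2)
      (by fun_prop)).continuousWithinAt
  · have : ((2 * M - 1 : ℕ) : ℝ) = 2 * M - 1 := by
      rw [Nat.cast_sub (by omega)]
      simp
    rw [this]
    change θ₂ BL + _ < θ₂ BR
    linarith
  · rintro x hx ⟨j, hj⟩
    refine hS x hx ?_
    have hxR : (x + c * Complex.I : ℂ) ∈ R := by
      rw [memR, (hpath x).1, (hpath x).2]
      exact ⟨hx, le_rfl, hcd.le⟩
    have hp := polar argCutUp norm_mul_exp_argCutUp _ hxR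
    change (_ : ℂ) * Complex.exp ((θ₂ (x + c * Complex.I) : ℝ) * Complex.I) = _ at hp
    rw [← hp, Complex.im_ofReal_mul, Complex.exp_ofReal_mul_I_im]
    change θ₂ (x + c * Complex.I) = _ at hj
    rw [hj, Real.sin_int_mul_pi, mul_zero]

/-! ### Real points on a segment, and local solutions of G = e(1 + t). -/

/-- An analytic function whose imaginary part does not vanish at an end of a horizontal segment is
real at only finitely many points of the segment. -/
theorem finite_im_eq_zero_of_segment {a b c : ℝ} (hab : a ≤ b) {G : ℂ → ℂ}
    (hG : ∀ x ∈ Set.Icc a b, AnalyticAt ℂ G (x + c * Complex.I))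
    (ha : (G (a + c * Complex.I)).im ≠ 0) :
    {x ∈ Set.Icc a b | (G (x + c * Complex.I)).im = 0}.Finite := by
  -- Im G is real-analytic along the segment; infinitely many zeros would accumulate and make it
  -- vanish identically, including at `a`.
  have han : AnalyticOnNhd ℝ (fun x : ℝ => (G (x + c * Complex.I)).im) (Set.Icc a b) := by
    intro x hx
    have h1 : AnalyticAt ℝ (fun x : ℝ => (x : ℂ) + c * Complex.I) x :=
      (Complex.ofRealCLM.analyticAt x).add analyticAt_const
    have h2 : AnalyticAt ℝ (fun x : ℝ => G (x + c * Complex.I)) x :=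
      AnalyticAt.fun_comp (hG x hx).restrictScalars h1
    exact AnalyticAt.fun_comp (Complex.imCLM.analyticAt _) h2
  by_contra hinf
  obtain ⟨x, hx, hacc⟩ := Set.Infinite.exists_accPt_of_subset_isCompact hinf isCompact_Icc
    (Set.sep_subset _ _)
  refine ha (han.eqOn_zero_of_preconnected_of_frequently_eq_zero isPreconnected_Icc hx ?_
    (Set.left_mem_Icc.2 hab))
  exact (accPt_iff_frequently_nhdsNE.1 hacc).mono fun y hy => hy.2

/-- A nonconstant analytic function with `G s = e` takes the values `e * (1 + t)`, for small
`t > 0`, in every neighbourhood of `s`. -/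
theorem AnalyticAt.eventually_exists_eq_mul_one_add {G : ℂ → ℂ} {s e : ℂ} (hG : AnalyticAt ℂ G s)
    (hGs : G s = e) (hnc : ¬ ∀ᶠ z in 𝓝 s, G z = e) {V : Set ℂ} (hV : V ∈ 𝓝 s) :
    ∀ᶠ t : ℝ in 𝓝[>] 0, ∃ z ∈ V, G z = e * (1 + t) := by
  rcases hG.eventually_constant_or_nhds_le_map_nhds with h | h
  · rw [hGs] at h
    exact absurd h hnc
  · rw [hGs] at h
    have h1 : G '' V ∈ 𝓝 e := h (Filter.image_mem_map hV)
    have h2 : Tendsto (fun t : ℝ => e * (1 + (t : ℂ))) (𝓝 0) (𝓝 e) := by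
      have : Continuous fun t : ℝ => e * (1 + (t : ℂ)) := by fun_prop
      simpa using this.tendsto 0
    filter_upwards [nhdsWithin_le_nhds (h2 h1)] with t ht
    exact ht

/-- A nonvanishing analytic function has locally an analytic `m`-th root. -/
theorem AnalyticAt.exists_analyticAt_pow_eq {φ : ℂ → ℂ} {s : ℂ} (hφ : AnalyticAt ℂ φ s)
    (h0 : φ s ≠ 0) {m : ℕ} (hm : m ≠ 0) :
    ∃ κ : ℂ → ℂ, AnalyticAt ℂ κ s ∧ κ s ≠ 0 ∧ ∀ᶠ z in 𝓝 s, κ z ^ m = φ z := by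
  obtain ⟨k, hk⟩ := IsAlgClosed.exists_pow_nat_eq (φ s) (Nat.pos_of_ne_zero hm)
  have hk0 : k ≠ 0 := by
    rintro rfl
    rw [zero_pow hm] at hk
    exact h0 hk.symm
  have hdiv : AnalyticAt ℂ (fun z => φ z / φ s) s := hφ.div analyticAt_const h0
  have hslit : φ s / φ s ∈ Complex.slitPlane := by rw [div_self h0]; exact Complex.one_mem_slitPlane
  refine ⟨fun z => k * Complex.exp (Complex.log (φ z / φ s) / m), ?_, ?_, ?_⟩
  · exact analyticAt_const.mul ((hdiv.clog hslit).div_const).cexp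
  · exact mul_ne_zero hk0 (Complex.exp_ne_zero _)
  · filter_upwards [hφ.continuousAt.eventually_ne h0] with z hz
    rw [mul_pow, hk, ← Complex.exp_nat_mul, mul_div_cancel₀ _ (Nat.cast_ne_zero.2 hm),
      Complex.exp_log (div_ne_zero hz h0), mul_div_cancel₀ _ h0]

/-- If `m ≥ 2` and `c ≠ 0` is not purely imaginary, some `m`-th root of unity turns `c` into the
right half-plane. -/
theorem exists_pow_eq_one_re_mul_pos {m : ℕ} (hm : 2 ≤ m) {c : ℂ} (hc : c.re ≠ 0) :
    ∃ ω : ℂ, ω ^ m = 1 ∧ 0 < (ω * c).re := by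
  have hζ := Complex.isPrimitiveRoot_exp m (by omega)
  set ζ := Complex.exp (2 * Real.pi * Complex.I / m)
  have hsum := hζ.geom_sum_eq_zero (by omega)
  -- The rotated real parts sum to zero. If none were positive, all would vanish, including that of
  -- `c` itself.
  have hre : ∑ i ∈ Finset.range m, (ζ ^ i * c).re = 0 := by
    rw [← Complex.re_sum, ← Finset.sum_mul, hsum, zero_mul, Complex.zero_re]
  by_contra! hcon
  have hle : ∀ i ∈ Finset.range m, (ζ ^ i * c).re ≤ 0 := by
    intro i _
    apply hcon
    rw [← pow_mul, mul_comm, pow_mul, hζ.pow_eq_one, one_pow]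
  have h0 := (Finset.sum_eq_zero_iff_of_nonpos hle).1 hre 0 (Finset.mem_range.2 (by omega))
  simp only [pow_zero, one_mul] at h0
  exact hc h0

/-- If `|G| = 1` on the vertical line through `s`, if `G s = e` and `deriv G s = 0`, then near `s`
the nonconstant analytic function `G` takes the values `e * (1 + t)`, for small `t > 0`, strictly to
the right of the line. -/
theorem AnalyticAt.eventually_exists_re_gt_eq_mul_one_add {G : ℂ → ℂ} {s e : ℂ}
    (hG : AnalyticAt ℂ G s) (hGs : G s = e) (he : ‖e‖ = 1) (hnc : ¬ ∀ᶠ z in 𝓝 s, G z = e)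
    (hline : ∀ᶠ x : ℝ in 𝓝 0, ‖G (s + x * Complex.I)‖ = 1) (hd : deriv G s = 0)
    {V : Set ℂ} (hV : V ∈ 𝓝 s) :
    ∀ᶠ t : ℝ in 𝓝[>] 0, ∃ z ∈ V, s.re < z.re ∧ G z = e * (1 + t) := by
  have he0 : e ≠ 0 := by
    rintro rfl
    simp at he
  have hF : AnalyticAt ℂ (fun z => G z / e - 1) s := (hG.div_const).sub analyticAt_const
  have hord : analyticOrderAt (fun z => G z / e - 1) s ≠ ⊤ := by
    rw [Ne, analyticOrderAt_eq_top]
    refine fun h => hnc (h.mono fun z hz => ?_)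
    field_simp at hz
    linear_combination hz
  obtain ⟨φ, hφ, hφ0, hφe⟩ := (hF.analyticOrderAt_ne_top).1 hord
  set m := analyticOrderNatAt (fun z => G z / e - 1) s with hm
  have hm0 : m ≠ 0 := by
    intro h
    have := hφe.eq_of_nhds
    rw [h, hGs] at this
    simp [he0] at this
    exact hφ0 this.symm
  have hm1 : m ≠ 1 := by
    intro h
    have h1 : HasDerivAt (fun z => G z / e - 1) 0 s := by
      have := (hG.differentiableAt.hasDerivAt.div_const e).sub_const 1
      rwa [hd, zero_div] at this
    have h2 : HasDerivAt (fun z => (z - s) ^ m • φ z) (φ s) s := by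
      simp only [h, pow_one, smul_eq_mul]
      have := ((hasDerivAt_id s).sub_const s).fun_mul hφ.differentiableAt.hasDerivAt
      simpa using this
    exact hφ0 ((h2.congr_of_eventuallyEq hφe).unique h1)
  have hm2 : 2 ≤ m := by omega
  have hGφ : ∀ᶠ z in 𝓝 s, G z = e * (1 + (z - s) ^ m * φ z) := by
    filter_upwards [hφe] with z hz
    rw [smul_eq_mul] at hz
    rw [← hz]
    field_simp
    ring
  -- With ψ(x) = i^m φ(s + ix), the condition |G(s + ix)|² = 1 reads 2x^m Re ψ + x^(2m)|ψ|² = 0.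
  -- Divide by x^m and let x → 0⁺.
  have hcoef : (Complex.I ^ m * φ s).re = 0 := by
    set ψ : ℝ → ℂ := fun x => Complex.I ^ m * φ (s + x * Complex.I) with hψ
    have hcont : ContinuousAt (fun x : ℝ => s + x * Complex.I) 0 := by fun_prop
    have hψc : ContinuousAt ψ 0 := by
      have : ContinuousAt φ (s + (0 : ℝ) * Complex.I) := by simpa using hφ.continuousAt
      exact continuousAt_const.mul (ContinuousAt.comp (f := fun x : ℝ => s + x * Complex.I)
        this hcont)
    have h1 : ∀ᶠ x : ℝ in 𝓝[>] 0, 2 * (ψ x).re + x ^ m * ‖ψ x‖ ^ 2 = 0 := by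
      have h2 : ∀ᶠ x : ℝ in 𝓝 0, G (s + x * Complex.I)
          = e * (1 + (s + x * Complex.I - s) ^ m * φ (s + x * Complex.I)) := by
        have : Tendsto (fun x : ℝ => s + x * Complex.I) (𝓝 0) (𝓝 s) := by
          simpa [ContinuousAt] using hcont
        exact this.eventually hGφ
      filter_upwards [nhdsWithin_le_nhds h2, nhdsWithin_le_nhds hline, self_mem_nhdsWithin]
        with x hx hx1 hx0
      have hx0' : (0 : ℝ) < x := hx0
      have h3 : G (s + x * Complex.I) = e * (1 + (x ^ m : ℝ) * ψ x) := by
        rw [hx, hψ]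
        push_cast
        ring
      rw [h3, norm_mul, he, one_mul] at hx1
      have h4 : Complex.normSq (1 + (x ^ m : ℝ) * ψ x) = 1 := by
        rw [Complex.normSq_eq_norm_sq, hx1, one_pow]
      have h5 : ‖ψ x‖ ^ 2 = (ψ x).re ^ 2 + (ψ x).im ^ 2 := by
        rw [← Complex.normSq_eq_norm_sq, Complex.normSq_apply]
        ring
      rw [Complex.normSq_apply] at h4
      simp only [Complex.add_re, Complex.one_re, Complex.re_ofReal_mul, Complex.add_im,
        Complex.one_im, Complex.im_ofReal_mul] at h4
      rw [h5]
      have h6 : (x ^ m : ℝ) ≠ 0 := (pow_pos hx0' m).ne'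
      apply mul_left_cancel₀ h6
      linear_combination h4
    have h2 : Tendsto (fun x : ℝ => 2 * (ψ x).re + x ^ m * ‖ψ x‖ ^ 2) (𝓝[>] 0)
        (𝓝 (2 * (ψ 0).re + 0 ^ m * ‖ψ 0‖ ^ 2)) := by
      have h3 : ContinuousAt (fun x : ℝ => 2 * (ψ x).re + x ^ m * ‖ψ x‖ ^ 2) 0 :=
        (continuousAt_const.mul (Complex.continuous_re.continuousAt.comp hψc)).add
          ((continuousAt_id.pow m).mul (hψc.norm.pow 2))
      exact h3.tendsto.mono_left nhdsWithin_le_nhds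
    have h3 := tendsto_nhds_unique (h2.congr' h1) (tendsto_const_nhds (x := (0 : ℝ)))
    rw [zero_pow hm0, zero_mul, add_zero] at h3
    simpa [hψ] using h3
  obtain ⟨κ, hκ, hκ0, hκe⟩ := hφ.exists_analyticAt_pow_eq hφ0 hm0
  -- If κ(s)⁻¹ were imaginary, (iκ(s))^m = i^m φ(s) would be real and nonzero, against `hcoef`.
  have hκre : (κ s)⁻¹.re ≠ 0 := by
    intro h
    obtain ⟨y, hy⟩ : ∃ y : ℝ, Complex.I * κ s = y := by
      have h1 : (κ s).re = 0 := by
        rw [Complex.inv_re, div_eq_zero_iff] at h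
        exact h.resolve_right (by simpa using hκ0)
      refine ⟨-(κ s).im, ?_⟩
      apply Complex.ext <;> simp [h1]
    have hy0 : y ≠ 0 := by
      rintro rfl
      simp [hκ0] at hy
    rw [← hκe.self_of_nhds, ← mul_pow, hy, ← Complex.ofReal_pow, Complex.ofReal_re] at hcoef
    exact pow_ne_zero m hy0 hcoef
  obtain ⟨ω, hω, hωre⟩ := exists_pow_eq_one_re_mul_pos hm2 hκre
  -- In this local coordinate G = e(1 + w^m). The preimage under `w` of the ray ρω leaves `s` in the
  -- direction ω/κ(s), which points to the right.
  set w : ℂ → ℂ := fun z => (z - s) * κ z with hw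
  have hws : w s = 0 := by simp [hw]
  have hwd : HasStrictDerivAt w (κ s) s := by
    have h1 : AnalyticAt ℂ w s := (analyticAt_id.sub analyticAt_const).mul hκ
    have h2 : HasDerivAt w (κ s) s := by
      have := ((hasDerivAt_id s).sub_const s).fun_mul hκ.differentiableAt.hasDerivAt
      simpa using this
    have h3 := h1.hasStrictDerivAt
    rwa [h2.deriv] at h3
  set v := hwd.localInverse w (κ s) s hκ0 with hv
  have hvd : HasStrictDerivAt v (κ s)⁻¹ 0 := by
    have := hwd.to_localInverse hκ0
    rwa [hws] at this
  have hwv : ∀ᶠ y in 𝓝 (0 : ℂ), w (v y) = y := by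
    have := (hwd.hasStrictFDerivAt_equiv hκ0).eventually_right_inverse
    rwa [hws] at this
  have hv0 : v 0 = s := by
    have := (hwd.hasStrictFDerivAt_equiv hκ0).localInverse_apply_image
    rwa [hws] at this
  have hray : HasDerivAt (fun ρ : ℝ => v (ρ * ω)) (ω * (κ s)⁻¹) 0 := by
    have h1 : HasDerivAt (fun ρ : ℝ => (ρ : ℂ) * ω) ω 0 := by
      simpa using (Complex.ofRealCLM.hasDerivAt (x := (0 : ℝ))).mul_const ω
    have h2 : HasDerivAt v (κ s)⁻¹ (((0 : ℝ) : ℂ) * ω) := by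
      simpa using hvd.hasDerivAt
    have := HasDerivAt.comp (0 : ℝ) h2 h1
    rwa [mul_comm] at this
  have hray0 : Tendsto (fun ρ : ℝ => (ρ : ℂ) * ω) (𝓝 0) (𝓝 0) := by
    have : Continuous fun ρ : ℝ => (ρ : ℂ) * ω := by fun_prop
    simpa using this.tendsto 0
  have hvs : Tendsto (fun ρ : ℝ => v (ρ * ω)) (𝓝 0) (𝓝 s) := by
    have := hray.continuousAt.tendsto
    simpa [hv0] using this
  have hpos : ∀ᶠ ρ : ℝ in 𝓝[>] 0, s.re < (v (ρ * ω)).re := by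
    have h1 : HasDerivAt (fun ρ : ℝ => (v (ρ * ω)).re) (ω * (κ s)⁻¹).re 0 :=
      Complex.reCLM.hasFDerivAt.comp_hasDerivAt (0 : ℝ) hray
    have h2 := (hasDerivAt_iff_tendsto_slope.1 h1).eventually (lt_mem_nhds hωre)
    have h3 : (𝓝[>] (0 : ℝ)) ≤ 𝓝[≠] 0 := nhdsWithin_mono _ fun x hx => ne_of_gt hx
    filter_upwards [h3 h2, self_mem_nhdsWithin] with ρ hρ hρ0
    have hρ' : (0 : ℝ) < ρ := hρ0
    have hρ2 : 0 < slope (fun ρ : ℝ => (v (ρ * ω)).re) 0 ρ := hρ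
    rw [slope_def_field, sub_zero] at hρ2
    have := (div_pos_iff_of_pos_right hρ').1 hρ2
    simp only [Complex.ofReal_zero, zero_mul, hv0] at this
    linarith
  have hall : ∀ᶠ ρ : ℝ in 𝓝[>] 0, v (ρ * ω) ∈ V ∧ s.re < (v (ρ * ω)).re ∧
      G (v (ρ * ω)) = e * (1 + (ρ : ℂ) ^ m) := by
    filter_upwards [hpos, nhdsWithin_le_nhds (hvs.eventually hV),
      nhdsWithin_le_nhds (hvs.eventually hGφ), nhdsWithin_le_nhds (hvs.eventually hκe),
      nhdsWithin_le_nhds (hray0.eventually hwv)] with ρ h1 h2 h3 h4 h5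
    refine ⟨h2, h1, ?_⟩
    rw [h3, ← h4, ← mul_pow]
    change w (v (ρ * ω)) = _ at h5
    simp only [hw] at h5
    rw [h5, mul_pow, hω, mul_one]
  have hroot : Tendsto (fun t : ℝ => t ^ ((m : ℝ)⁻¹)) (𝓝[>] 0) (𝓝[>] 0) := by
    have hmpos : (0 : ℝ) < (m : ℝ)⁻¹ := by positivity
    refine tendsto_nhdsWithin_iff.2 ⟨?_, ?_⟩
    · have := (Real.continuousAt_rpow_const 0 ((m : ℝ)⁻¹) (Or.inr hmpos.le)).tendsto
      rw [Real.zero_rpow hmpos.ne'] at this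
      exact this.mono_left nhdsWithin_le_nhds
    · filter_upwards [self_mem_nhdsWithin] with t ht using Real.rpow_pos_of_pos ht _
  filter_upwards [hroot.eventually hall, self_mem_nhdsWithin] with t ht ht0
  refine ⟨_, ht.1, ht.2.1, ?_⟩
  rw [ht.2.2, ← Complex.ofReal_pow, Real.rpow_inv_natCast_pow (le_of_lt ht0) hm0]

/-! ### Finiteness of the exceptional points in a half-strip. -/

/-- Let `G` be analytic on a closed vertical half-strip, of modulus `1` on the left side and at most
`1` on the right side, of controlled growth on a sequence of horizontal segments. Then `G` takes the
value `e = ±1` only finitely often inside the half-strip, and with finitely many exceptions takes it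
simply on the left side. -/
theorem finite_exceptional_of_half_strip {a σ₀ τ₁ K : ℝ} (ha : a < σ₀) {G : ℂ → ℂ}
    (hG : ∀ s : ℂ, a ≤ s.re → s.re ≤ σ₀ → τ₁ ≤ s.im → AnalyticAt ℂ G s)
    (hleft : ∀ s : ℂ, s.re = a → τ₁ ≤ s.im → ‖G s‖ = 1)
    (hright : ∀ s : ℂ, s.re = σ₀ → τ₁ ≤ s.im → ‖G s‖ ≤ 1)
    {t : ℕ → ℝ} (ht : Tendsto t atTop atTop)
    (hgrowth : ∀ n, ∀ s : ℂ, a ≤ s.re → s.re ≤ σ₀ → τ₁ ≤ s.im → s.im = t n →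
      ‖G s‖ ≤ Real.exp (K * ‖s‖))
    (hb : (G (a + τ₁ * Complex.I)).im ≠ 0) {e : ℝ} (he : e * e = 1) :
    {s : ℂ | a ≤ s.re ∧ s.re < σ₀ ∧ τ₁ < s.im ∧ G s = e ∧ (s.re = a → deriv G s = 0)}.Finite := by
  have he0 : e ≠ 0 := by
    rintro rfl
    simp at he
  have hen : ‖(e : ℂ)‖ = 1 := by
    rw [Complex.norm_real, Real.norm_eq_abs]
    rcases mul_self_eq_one_iff.1 he with rfl | rfl <;> simp
  have hnc : ∀ s : ℂ, a ≤ s.re → s.re ≤ σ₀ → τ₁ ≤ s.im → ¬ ∀ᶠ z in 𝓝 s, G z = e := by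
    intro s h1 h2 h3 hcon
    have han : AnalyticOnNhd ℂ G (Set.Icc a σ₀ ×ℂ Set.Ici τ₁) := fun z hz => by
      rw [Complex.mem_reProdIm] at hz
      exact hG z hz.1.1 hz.1.2 hz.2
    have := han.eqOn_of_preconnected_of_eventuallyEq (analyticOnNhd_const (v := (e : ℂ)))
      ((convex_Icc a σ₀).isPreconnected_reProdIm (convex_Ici τ₁))
      (Complex.mem_reProdIm.2 ⟨⟨h1, h2⟩, h3⟩) hcon
      (show (a + τ₁ * Complex.I : ℂ) ∈ Set.Icc a σ₀ ×ℂ Set.Ici τ₁ by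
        simp [Complex.mem_reProdIm, ha.le])
    rw [this] at hb
    simp at hb
  have hpath : ∀ x : ℝ, (x + τ₁ * Complex.I : ℂ).re = x ∧ (x + τ₁ * Complex.I : ℂ).im = τ₁ := by
    intro x
    simp
  have hSfin : {x ∈ Set.Icc a σ₀ | (G (x + τ₁ * Complex.I)).im = 0}.Finite :=
    finite_im_eq_zero_of_segment ha.le
      (fun x hx => hG _ (by rw [(hpath x).1]; exact hx.1) (by rw [(hpath x).1]; exact hx.2)
        (hpath x).2.ge) hb
  set S := hSfin.toFinset with hS
  have hSmem : ∀ x, x ∈ S ↔ (a ≤ x ∧ x ≤ σ₀) ∧ (G (x + τ₁ * Complex.I)).im = 0 := by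
    intro x
    rw [hS, Set.Finite.mem_toFinset]
    rfl
  by_contra hinf
  -- With |S| + 1 exceptional points the zero count would give 2(|S| + 1) ≤ |S| + 1. Disjoint
  -- neighbourhoods keep the perturbed solutions distinct.
  obtain ⟨Z, hZsub, hZcard⟩ := Set.Infinite.exists_subset_card_eq hinf (S.card + 1)
  obtain ⟨U, hU, hUdisj⟩ := Z.finite_toSet.t2_separation
  have hnear : ∀ s ∈ Z, ∀ᶠ u : ℝ in 𝓝[>] 0, ∃ z : ℂ, z ∈ U s ∧ a < z.re ∧ z.re < σ₀ ∧ τ₁ < z.im ∧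
      G z = e * (1 + u) := by
    intro s hs
    obtain ⟨h1, h2, h3, h4, h5⟩ := hZsub hs
    have hV : ∀ᶠ z in 𝓝 s, z ∈ U s ∧ z.re < σ₀ ∧ τ₁ < z.im := by
      filter_upwards [(hU s).2.mem_nhds (hU s).1,
        Complex.continuous_re.continuousAt.eventually_lt_const h2,
        Complex.continuous_im.continuousAt.eventually_const_lt h3] with z z1 z2 z3
      exact ⟨z1, z2, z3⟩
    rcases h1.eq_or_lt with h1' | h1'
    · have hl : ∀ᶠ x : ℝ in 𝓝 0, ‖G (s + x * Complex.I)‖ = 1 := by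
        filter_upwards [lt_mem_nhds (sub_neg.2 h3)] with x hx
        apply hleft
        · simp [h1']
        · simp only [Complex.add_im, Complex.mul_im, Complex.ofReal_re, Complex.I_im, mul_one,
            Complex.ofReal_im, Complex.I_re, mul_zero, add_zero]
          linarith
      filter_upwards [(hG s h1 h2.le h3.le).eventually_exists_re_gt_eq_mul_one_add h4 hen
        (hnc s h1 h2.le h3.le) hl (h5 h1'.symm) hV] with u ⟨z, hz, hz1, hz2⟩
      exact ⟨z, hz.1, h1' ▸ hz1, hz.2.1, hz.2.2, hz2⟩
    · filter_upwards [(hG s h1 h2.le h3.le).eventually_exists_eq_mul_one_add h4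
        (hnc s h1 h2.le h3.le)
        (hV.and (Complex.continuous_re.continuousAt.eventually_const_lt h1'))] with u ⟨z, hz, hz2⟩
      exact ⟨z, hz.1.1, hz.2, hz.1.2.1, hz.1.2.2, hz2⟩
  -- Each point of `S` rules out at most one `u`. A zero of `g` on the bottom side would be a real
  -- point of `G`, so avoiding `S` suffices.
  have havoid : ∀ x ∈ S, ∀ᶠ u : ℝ in 𝓝[>] 0, G (x + τ₁ * Complex.I) ≠ e * (1 + u) := by
    intro x _
    have hne : ∀ y : ℝ, ∀ᶠ u : ℝ in 𝓝[>] 0, u ≠ y := by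
      intro y
      rcases le_or_gt y 0 with h | h
      · filter_upwards [self_mem_nhdsWithin] with u hu using (lt_of_le_of_lt h hu).ne'
      · filter_upwards [nhdsWithin_le_nhds (gt_mem_nhds h)] with u hu using hu.ne
    filter_upwards [hne ((G (x + τ₁ * Complex.I)).re / e - 1)] with u hu h
    apply hu
    rw [h]
    simp [he0]
  obtain ⟨u, hu1, hu2, hu0⟩ := (((Finset.eventually_all Z).2 hnear).and
    (((Finset.eventually_all S).2 havoid).and self_mem_nhdsWithin)).exists
  have hu : (0 : ℝ) < u := hu0
  choose! z hzU hza hzσ hzτ hzG using hu1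
  have hinj : Set.InjOn z Z := by
    intro s hs s' hs' h
    by_contra hne
    exact Set.disjoint_left.1 (hUdisj hs hs' hne) (hzU s hs) (h ▸ hzU s' hs')
  obtain ⟨T₀, hT₀⟩ := exists_norm_lt_of_half_strip ha hG (fun s h1 h2 => (hleft s h1 h2).le)
    hright ht hgrowth (show (1 : ℝ) < 1 + u by linarith)
  obtain ⟨T₁, hT₁⟩ := (Z.image fun s => (z s).im).bddAbove
  set T := max (max T₀ T₁) (τ₁ + 1) with hT
  have hT₀T : T₀ ≤ T := (le_max_left _ _).trans (le_max_left _ _)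
  have hT₁T : T₁ ≤ T := (le_max_right _ _).trans (le_max_left _ _)
  have hτT : τ₁ < T := (lt_add_one τ₁).trans_le (le_max_right _ _)
  -- `g` has positive real part wherever |G| < 1 + u, and it is real only where `G` is real; hence
  -- `S` serves for every `u`.
  set g : ℂ → ℂ := fun s => 1 - ((e / (1 + u) : ℝ) : ℂ) * G s with hg
  have hgre : ∀ s, ‖G s‖ < 1 + u → 0 < (g s).re := by
    intro s hs
    have h1 : ‖((e / (1 + u) : ℝ) : ℂ) * G s‖ < 1 := by
      rw [norm_mul, Complex.ofReal_div, norm_div, hen, Complex.norm_real, Real.norm_eq_abs,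
        abs_of_pos (by linarith), one_div_mul_eq_div, div_lt_one (by linarith)]
      exact hs
    have h2 := (Complex.re_le_norm _).trans_lt h1
    rw [hg, Complex.sub_re, Complex.one_re]
    linarith
  have hgzero : ∀ s, g s = 0 ↔ G s = e * (1 + u) := by
    intro s
    have h1 : (1 + u : ℂ) ≠ 0 := by exact_mod_cast (by linarith : (1 + u : ℝ) ≠ 0)
    have h2 : (e : ℂ) * e = 1 := by exact_mod_cast he
    rw [hg]
    push_cast
    constructor
    · intro h
      field_simp at h
      linear_combination (-e : ℂ) * h - G s * h2
    · intro h
      rw [h]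
      field_simp
      linear_combination -h2
  have hgim : ∀ s, (g s).im = 0 → (G s).im = 0 := by
    intro s h
    rw [hg, Complex.sub_im, Complex.one_im, Complex.im_ofReal_mul, zero_sub, neg_eq_zero] at h
    exact (mul_eq_zero.1 h).resolve_left (div_ne_zero he0 (by linarith))
  have hcount := two_mul_card_zeros_le ha hτT (g := g) (S := S) (Z := Z.image z) ?_ ?_ ?_ ?_ ?_ ?_ ?_
  · rw [Finset.card_image_of_injOn hinj, hZcard] at hcount
    omega
  · intro s hs
    rw [Complex.mem_reProdIm] at hs
    exact analyticAt_const.sub (analyticAt_const.mul (hG s hs.1.1 hs.1.2 hs.2.1))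
  · intro s h1 h2 _
    exact hgre s (by rw [hleft s h1 h2]; linarith)
  · intro s h1 h2 _
    exact hgre s (by linarith [hright s h1 h2])
  · intro s h1 h2 h3
    exact hgre s (hT₀ s h1 h2 (by rw [h3]; exact hτT.le) (by rw [h3]; exact hT₀T))
  · intro s h1 h2 h3 h4
    have hs : s = s.re + τ₁ * Complex.I := by rw [← h3, Complex.re_add_im]
    have hsS : s.re ∈ S := by
      rw [hSmem, ← hs]
      exact ⟨⟨h1, h2⟩, hgim s (by rw [h4, Complex.zero_im])⟩
    exact hu2 _ hsS (by rw [← hs]; exact (hgzero s).1 h4)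
  · intro y hy
    obtain ⟨s, hs, rfl⟩ := Finset.mem_image.1 hy
    refine ⟨Complex.mem_reProdIm.2 ⟨⟨(hza s hs).le, (hzσ s hs).le⟩, (hzτ s hs).le, ?_⟩,
      (hgzero _).2 (hzG s hs)⟩
    exact (hT₁ (Finset.mem_coe.2 (Finset.mem_image_of_mem _ hs))).trans hT₁T
  · intro x hx h
    rw [hSmem]
    exact ⟨hx, hgim _ h⟩

/-! ### Conjugation and reflection of meromorphic functions. -/

/-- The function `s ↦ conj (f (conj s))`. -/
noncomputable def conjRefl (f : ℂ → ℂ) : ℂ → ℂ := fun s => starRingEnd ℂ (f (starRingEnd ℂ s))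

theorem Function.Injective.tendsto_nhdsNE {g : ℂ → ℂ} (hg : Function.Injective g)
    (hc : Continuous g) (s : ℂ) : Tendsto g (𝓝[≠] s) (𝓝[≠] (g s)) :=
  tendsto_nhdsWithin_iff.2 ⟨(hc.tendsto s).mono_left nhdsWithin_le_nhds,
    eventually_nhdsWithin_of_forall fun _ hz h => hz (hg h)⟩

theorem tendsto_conj_nhdsNE (s : ℂ) :
    Tendsto (starRingEnd ℂ) (𝓝[≠] s) (𝓝[≠] (starRingEnd ℂ s)) :=
  (starRingEnd ℂ).injective.tendsto_nhdsNE Complex.continuous_conj s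

theorem tendsto_const_sub_nhdsNE (b s : ℂ) : Tendsto (fun z => b - z) (𝓝[≠] s) (𝓝[≠] (b - s)) :=
  sub_right_injective.tendsto_nhdsNE (by fun_prop) s

theorem AnalyticAt.conjRefl {f : ℂ → ℂ} {s : ℂ} (hf : AnalyticAt ℂ f (starRingEnd ℂ s)) :
    AnalyticAt ℂ (conjRefl f) s := by
  rw [Complex.analyticAt_iff_eventually_differentiableAt] at hf ⊢
  filter_upwards [Complex.continuous_conj.continuousAt.eventually hf] with z hz
  have := hz.conj_conj
  rwa [Complex.conj_conj] at this

theorem MeromorphicAt.conjRefl {f : ℂ → ℂ} {s : ℂ} (hf : MeromorphicAt f (starRingEnd ℂ s)) :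
    MeromorphicAt (conjRefl f) s := by
  obtain ⟨n, hn⟩ := hf
  refine ⟨n, ?_⟩
  have h1 : _root_.conjRefl (fun z => (z - starRingEnd ℂ s) ^ n • f z)
      = fun z => (z - s) ^ n • _root_.conjRefl f z := by
    funext z
    simp [_root_.conjRefl]
  rw [← h1]
  exact hn.conjRefl

theorem meromorphicOrderAt_conjRefl {f : ℂ → ℂ} {s : ℂ}
    (hf : MeromorphicAt f (starRingEnd ℂ s)) :
    meromorphicOrderAt (conjRefl f) s = meromorphicOrderAt f (starRingEnd ℂ s) := by
  cases h : meromorphicOrderAt f (starRingEnd ℂ s) with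
  | top =>
    rw [meromorphicOrderAt_eq_top_iff] at h ⊢
    filter_upwards [(tendsto_conj_nhdsNE s).eventually h] with z hz
    simp [conjRefl, hz]
  | coe n =>
    obtain ⟨g, hg, hg0, hge⟩ := (meromorphicOrderAt_eq_int_iff hf).1 h
    refine (meromorphicOrderAt_eq_int_iff hf.conjRefl).2 ⟨conjRefl g, hg.conjRefl, ?_, ?_⟩
    · simpa [conjRefl] using hg0
    · filter_upwards [(tendsto_conj_nhdsNE s).eventually hge] with z hz
      simp [conjRefl, hz]

theorem MeromorphicAt.comp_const_sub {f : ℂ → ℂ} {b s : ℂ} (hf : MeromorphicAt f (b - s)) :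
    MeromorphicAt (fun z => f (b - z)) s :=
  MeromorphicAt.comp_analyticAt (g := fun z => b - z) hf (by fun_prop)

theorem meromorphicOrderAt_comp_const_sub (f : ℂ → ℂ) (b s : ℂ) :
    meromorphicOrderAt (fun z => f (b - z)) s = meromorphicOrderAt f (b - s) := by
  refine meromorphicOrderAt_comp_of_deriv_ne_zero (g := fun z => b - z) (by fun_prop) ?_
  rw [deriv_const_sub]
  simp

/-- A meromorphic function, real at the real points where it is analytic, commutes with complex
conjugation. -/
theorem Meromorphic.conjRefl_eventuallyEq {h : ℂ → ℂ} (hmero : Meromorphic h)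
    (hreal : ∀ x : ℝ, AnalyticAt ℂ h (x : ℂ) → (h (x : ℂ)).im = 0) (s : ℂ) :
    conjRefl h =ᶠ[𝓝[≠] s] h := by
  have hdiff : Meromorphic (conjRefl h - h) := fun z => ((hmero _).conjRefl).sub (hmero z)
  -- The difference vanishes at the real points near 0, other than 0 itself; the identity theorem
  -- spreads this to the whole plane.
  have h0 : meromorphicOrderAt (conjRefl h - h) 0 = ⊤ := by
    rw [meromorphicOrderAt_eq_top_iff]
    refine (hdiff 0).frequently_zero_iff_eventuallyEq_zero.1 ?_
    have hreal0 : Tendsto (fun x : ℝ => (x : ℂ)) (𝓝[≠] 0) (𝓝[≠] 0) :=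
      tendsto_nhdsWithin_iff.2 ⟨by
        simpa using (Complex.continuous_ofReal.tendsto 0).mono_left nhdsWithin_le_nhds,
        eventually_nhdsWithin_of_forall fun x hx => by simpa using hx⟩
    refine hreal0.frequently (Eventually.frequently ?_)
    filter_upwards [hreal0.eventually (hmero 0).eventually_analyticAt] with x hx
    rw [Pi.sub_apply, conjRefl, Complex.conj_ofReal, Complex.conj_eq_iff_im.2 (hreal x hx),
      sub_self]
  have hs : meromorphicOrderAt (conjRefl h - h) s = ⊤ := by
    by_contra hne
    exact hdiff.exists_meromorphicOrderAt_ne_top_iff_forall.1 ⟨s, hne⟩ 0 h0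
  rw [meromorphicOrderAt_eq_top_iff] at hs
  filter_upwards [hs] with z hz
  exact sub_eq_zero.1 hz

theorem Meromorphic.meromorphicOrderAt_conj {h : ℂ → ℂ} (hmero : Meromorphic h)
    (hconj : ∀ s, conjRefl h =ᶠ[𝓝[≠] s] h) (s : ℂ) :
    meromorphicOrderAt h (starRingEnd ℂ s) = meromorphicOrderAt h s := by
  rw [← meromorphicOrderAt_conjRefl (hmero _), meromorphicOrderAt_congr (hconj s)]

/-! ### The quotient and its relation to `f`. -/

/-- The quotient `h(2a - s) / h(s)` computed with the normal form of `h`. -/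
noncomputable def normalQuot (h : ℂ → ℂ) (a : ℝ) : ℂ → ℂ := fun s =>
  toMeromorphicNFOn h Set.univ (2 * a - s) / toMeromorphicNFOn h Set.univ s

section

variable {h : ℂ → ℂ} {a : ℝ} {s : ℂ}

theorem Meromorphic.toMeromorphicNFOn_eventuallyEq (hmero : Meromorphic h) (s : ℂ) :
    toMeromorphicNFOn h Set.univ =ᶠ[𝓝[≠] s] h :=
  (meromorphicOn_univ.2 hmero).toMeromorphicNFOn_eq_self_on_nhdsNE (Set.mem_univ s)

theorem Meromorphic.analyticAt_toMeromorphicNFOn (hmero : Meromorphic h)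
    (hs : 0 ≤ meromorphicOrderAt h s) : AnalyticAt ℂ (toMeromorphicNFOn h Set.univ) s := by
  rw [← (meromorphicNFOn_toMeromorphicNFOn h Set.univ
    (Set.mem_univ s)).meromorphicOrderAt_nonneg_iff_analyticAt,
    meromorphicOrderAt_toMeromorphicNFOn (meromorphicOn_univ.2 hmero) (Set.mem_univ s)]
  exact hs

theorem Meromorphic.toMeromorphicNFOn_ne_zero (hmero : Meromorphic h)
    (hs : meromorphicOrderAt h s = 0) : toMeromorphicNFOn h Set.univ s ≠ 0 := by
  rw [← (meromorphicNFOn_toMeromorphicNFOn h Set.univ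
    (Set.mem_univ s)).meromorphicOrderAt_eq_zero_iff,
    meromorphicOrderAt_toMeromorphicNFOn (meromorphicOn_univ.2 hmero) (Set.mem_univ s)]
  exact hs

theorem Meromorphic.analyticAt_normalQuot (hmero : Meromorphic h)
    (hs : meromorphicOrderAt h s = 0) (hs' : 0 ≤ meromorphicOrderAt h (2 * a - s)) :
    AnalyticAt ℂ (normalQuot h a) s :=
  (AnalyticAt.fun_comp (f := fun z : ℂ => 2 * a - z) (hmero.analyticAt_toMeromorphicNFOn hs')
    (by fun_prop)).div (hmero.analyticAt_toMeromorphicNFOn hs.ge)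
    (hmero.toMeromorphicNFOn_ne_zero hs)

/-- This carries the hypotheses on `reflQuot` over to `normalQuot`: the two agree off isolated
points and are both in normal form at `s`. -/
theorem Meromorphic.reflQuot_eventuallyEq_normalQuot (hmero : Meromorphic h)
    (hs : meromorphicOrderAt h s = 0) (hs' : 0 ≤ meromorphicOrderAt h (2 * a - s)) :
    reflQuot h a =ᶠ[𝓝 s] normalQuot h a := by
  have hq : Meromorphic (fun s => h (2 * a - s) / h s) := fun z =>
    (hmero _).comp_const_sub.fun_div (hmero z)
  have h1 : reflQuot h a =ᶠ[𝓝[≠] s] normalQuot h a := by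
    filter_upwards [hq.toMeromorphicNFOn_eventuallyEq s, hmero.toMeromorphicNFOn_eventuallyEq s,
      (tendsto_const_sub_nhdsNE (2 * a) s).eventually
        (hmero.toMeromorphicNFOn_eventuallyEq (2 * a - s))] with z h1 h2 h3
    rw [reflQuot, normalQuot, h1, h2, h3]
  exact ((meromorphicNFOn_toMeromorphicNFOn _ Set.univ
    (Set.mem_univ s)).eventuallyEq_nhdsNE_iff_eventuallyEq_nhds
    (hmero.analyticAt_normalQuot hs hs').meromorphicNFAt).1 h1

/-- On this line 2a - s is the conjugate of `s`, so the quotient is conj H(s) / H(s), with `H` the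
normal form of `h`. -/
theorem Meromorphic.norm_normalQuot_eq_one (hmero : Meromorphic h)
    (hconj : ∀ s, conjRefl h =ᶠ[𝓝[≠] s] h) (hs : meromorphicOrderAt h s = 0) (hre : s.re = a) :
    ‖normalQuot h a s‖ = 1 := by
  set H := toMeromorphicNFOn h Set.univ with hH
  have hrefl : 2 * (a : ℂ) - s = starRingEnd ℂ s := by
    apply Complex.ext
    · simp [← hre]; ring
    · simp
  have hs' : meromorphicOrderAt h (starRingEnd ℂ s) = 0 := by
    rw [hmero.meromorphicOrderAt_conj hconj, hs]
  have h1 : AnalyticAt ℂ (conjRefl H) s := (hmero.analyticAt_toMeromorphicNFOn hs'.ge).conjRefl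
  have h2 : AnalyticAt ℂ H s := hmero.analyticAt_toMeromorphicNFOn hs.ge
  have h3 : conjRefl H =ᶠ[𝓝[≠] s] H := by
    filter_upwards [hmero.toMeromorphicNFOn_eventuallyEq s, hconj s,
      (tendsto_conj_nhdsNE s).eventually
        (hmero.toMeromorphicNFOn_eventuallyEq (starRingEnd ℂ s))] with z z1 z2 z3
    rw [hH, z1, ← z2, conjRefl, conjRefl, z3]
  have h4 := ((h1.continuousAt.eventuallyEq_nhds_iff_eventuallyEq_nhdsNE
    h2.continuousAt).1 h3).eq_of_nhds
  have h0 : H s ≠ 0 := hmero.toMeromorphicNFOn_ne_zero hs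
  rw [normalQuot, hrefl, norm_div]
  change ‖H (starRingEnd ℂ s)‖ / ‖H s‖ = 1
  rw [← h4, conjRefl, RCLike.norm_conj, div_self]
  rw [← h4] at h0
  simpa [conjRefl] using h0

/-- Since ε² = 1, f = εH(G + ε) near `s`, with `H` the normal form of `h` and `G` the quotient; the
factor εH is analytic and nonzero at `s`. -/
theorem Meromorphic.meromorphicOrderAt_reflSum_eq (hmero : Meromorphic h)
    (hs : meromorphicOrderAt h s = 0) {ε : ℂ} (hε : ε * ε = 1) :
    meromorphicOrderAt (reflSum h a ε) s = meromorphicOrderAt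
    (fun z => normalQuot h a z - -ε) s := by
  have hε0 : ε ≠ 0 := by
    rintro rfl
    simp at hε
  have hH := hmero.analyticAt_toMeromorphicNFOn hs.ge
  have hH0 := hmero.toMeromorphicNFOn_ne_zero hs
  have h1 : reflSum h a ε =ᶠ[𝓝[≠] s] (fun z => ε * toMeromorphicNFOn h Set.univ z) *
      (fun z => normalQuot h a z - -ε) := by
    filter_upwards [hmero.toMeromorphicNFOn_eventuallyEq s,
      (tendsto_const_sub_nhdsNE (2 * a) s).eventually
        (hmero.toMeromorphicNFOn_eventuallyEq (2 * a - s)),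
      nhdsWithin_le_nhds (hH.continuousAt.eventually_ne hH0)] with z z1 z2 z3
    rw [Pi.mul_apply, normalQuot, z1, z2, reflSum]
    rw [z1] at z3
    field_simp
    linear_combination (-h z) * hε
  rw [meromorphicOrderAt_congr h1, meromorphicOrderAt_mul_of_ne_zero
    (g := fun z => ε * toMeromorphicNFOn h Set.univ z) (analyticAt_const.mul hH)
    (mul_ne_zero hε0 hH0)]

theorem Meromorphic.reflSum (hmero : Meromorphic h) (a : ℝ) (ε : ℂ) :
    Meromorphic (reflSum h a ε) := fun s =>
  (hmero s).fun_add ((MeromorphicAt.const ε s).fun_mul (hmero _).comp_const_sub)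

/-- Because f(2a - s) = ε f(s). -/
theorem meromorphicOrderAt_reflSum_const_sub {ε : ℂ} (hε : ε * ε = 1) :
    meromorphicOrderAt (reflSum h a ε) (2 * a - s) = meromorphicOrderAt (reflSum h a ε) s := by
  have hε0 : ε ≠ 0 := by
    rintro rfl
    simp at hε
  have h1 : (fun z => reflSum h a ε (2 * a - z)) = (fun _ => ε) * reflSum h a ε := by
    funext z
    rw [Pi.mul_apply, reflSum, reflSum, sub_sub_cancel]
    linear_combination (-h (2 * a - z)) * hε
  rw [← meromorphicOrderAt_comp_const_sub, h1,
    meromorphicOrderAt_mul_of_ne_zero analyticAt_const hε0]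

theorem conjRefl_reflSum_eventuallyEq (hconj : ∀ s, conjRefl h =ᶠ[𝓝[≠] s] h) (a : ℝ) {ε : ℂ}
    (hε : starRingEnd ℂ ε = ε) (s : ℂ) :
    conjRefl (reflSum h a ε) =ᶠ[𝓝[≠] s] reflSum h a ε := by
  filter_upwards [hconj s, (tendsto_const_sub_nhdsNE (2 * a) s).eventually
    (hconj (2 * a - s))] with z z1 z2
  rw [reflSum, ← z1, ← z2]
  simp [conjRefl, reflSum, hε, map_ofNat (starRingEnd ℂ) 2]

end

/-! ### From the half-strip to the zeros of `f`. -/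

/-- A meromorphic function, nowhere locally zero, has finitely many zeros in a compact set. -/
theorem Meromorphic.finite_zeroSet_inter {f : ℂ → ℂ} (hf : Meromorphic f)
    (htop : ∀ s, meromorphicOrderAt f s ≠ ⊤) {R : Set ℂ} (hR : IsCompact R) :
    (zeroSet f ∩ R).Finite := by
  refine ((MeromorphicOn.divisor f R).finiteSupport hR).subset fun s hs => ?_
  rw [Function.mem_support, MeromorphicOn.divisor_apply (hf.meromorphicOn) hs.2]
  have h1 : 0 < meromorphicOrderAt f s := hs.1
  have h2 := htop s
  cases h : meromorphicOrderAt f s with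
  | top => exact absurd h h2
  | coe n =>
    rw [h] at h1
    simpa using (WithTop.coe_pos.1 h1).ne'

/-- The zeros of `h(s) ± h(2a - s)` high up in the right half of the strip are, with finitely many
exceptions, simple and on the line `σ = a`. -/
theorem exists_finite_exceptional_zeros {a σ₀ : ℝ} (ha : a < σ₀) {h : ℂ → ℂ}
    (hmero : Meromorphic h) (hconj : ∀ s, conjRefl h =ᶠ[𝓝[≠] s] h)
    (hpoles : (poleSet h).Finite)
    (hzeros : {s | s ∈ zeroSet h ∧ a ≤ s.re ∧ s.re < σ₀}.Finite)
    (hline : ∀ s : ℂ, s.re = σ₀ → meromorphicOrderAt h s = 0)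
    (hF_ne : ∀ s : ℂ, s.re = σ₀ → reflQuot h a s ≠ 1 ∧ reflQuot h a s ≠ -1)
    {τ₀ : ℝ} (hF_lt : ∀ s : ℂ, s.re = σ₀ → τ₀ ≤ |s.im| → ‖reflQuot h a s‖ < 1)
    {K : ℝ} {t : ℕ → ℝ} (ht : Tendsto t atTop atTop)
    (hF_seq : ∀ n : ℕ, ∀ s : ℂ, a ≤ s.re → s.re ≤ σ₀ → |s.im| = t n →
      ‖reflQuot h a s‖ < Real.exp (K * ‖s‖))
    {ε : ℝ} (hε : ε * ε = 1) :
    (∀ s, meromorphicOrderAt (reflSum h a ε) s ≠ ⊤) ∧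
    ∃ τ₁ : ℝ, {s | s ∈ zeroSet (reflSum h a ε) ∧ a ≤ s.re ∧ s.re < σ₀ ∧ τ₁ < s.im ∧
      ¬ (s.re = a ∧ meromorphicOrderAt (reflSum h a ε) s = 1)}.Finite := by
  have hεc : (ε : ℂ) * ε = 1 := by exact_mod_cast hε
  obtain ⟨b₁, hb₁⟩ := (hpoles.image fun s => |s.im|).bddAbove
  obtain ⟨b₂, hb₂⟩ := (hzeros.image fun s => |s.im|).bddAbove
  have hpole : ∀ s : ℂ, b₁ < |s.im| → 0 ≤ meromorphicOrderAt h s := by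
    intro s hs
    by_contra hcon
    exact absurd (hb₁ (Set.mem_image_of_mem _ (show s ∈ poleSet h from not_le.1 hcon)))
      (not_le.2 hs)
  have hzero : ∀ s : ℂ, a ≤ s.re → s.re ≤ σ₀ → b₁ < |s.im| → b₂ < |s.im| →
      meromorphicOrderAt h s = 0 := by
    intro s h1 h2 h3 h4
    rcases h2.lt_or_eq with h2 | h2
    · refine le_antisymm (not_lt.1 fun hcon => ?_) (hpole s h3)
      exact absurd (hb₂ (Set.mem_image_of_mem _
        (show s ∈ {s | s ∈ zeroSet h ∧ a ≤ s.re ∧ s.re < σ₀} from ⟨hcon, h1, h2⟩)))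
        (not_le.2 h4)
    · exact hline s h2
  -- A positive height above all poles of `h`, above its zeros in the strip, and above `τ₀`.
  set τ' : ℝ := max (max b₁ b₂) (max τ₀ 0) + 1 with hτ'
  have hτb₁ : b₁ < τ' := by
    rw [hτ']; linarith [(le_max_left b₁ b₂).trans (le_max_left (max b₁ b₂) (max τ₀ 0))]
  have hτb₂ : b₂ < τ' := by
    rw [hτ']; linarith [(le_max_right b₁ b₂).trans (le_max_left (max b₁ b₂) (max τ₀ 0))]
  have hτ₀ : τ₀ < τ' := by
    rw [hτ']; linarith [(le_max_left τ₀ 0).trans (le_max_right (max b₁ b₂) (max τ₀ 0))]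
  have hτ0 : 0 < τ' := by
    rw [hτ']; linarith [(le_max_right τ₀ 0).trans (le_max_right (max b₁ b₂) (max τ₀ 0))]
  have habs : ∀ s : ℂ, τ' ≤ s.im → |s.im| = s.im := fun s hs => abs_of_pos (hτ0.trans_le hs)
  have hord : ∀ s : ℂ, a ≤ s.re → s.re ≤ σ₀ → τ' ≤ s.im → meromorphicOrderAt h s = 0 := by
    intro s h1 h2 h3
    refine hzero s h1 h2 ?_ ?_ <;> rw [habs s h3] <;> linarith
  have hord' : ∀ s : ℂ, τ' ≤ s.im → 0 ≤ meromorphicOrderAt h (2 * a - s) := by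
    intro s h3
    apply hpole
    have : |(2 * (a : ℂ) - s).im| = s.im := by
      rw [← habs s h3]
      simp
    rw [this]
    linarith
  set G := normalQuot h a with hG
  have hGan : ∀ s : ℂ, a ≤ s.re → s.re ≤ σ₀ → τ' ≤ s.im → AnalyticAt ℂ G s := fun s h1 h2 h3 =>
    hmero.analyticAt_normalQuot (hord s h1 h2 h3) (hord' s h3)
  have hGF : ∀ s : ℂ, a ≤ s.re → s.re ≤ σ₀ → τ' ≤ s.im → reflQuot h a s = G s :=
    fun s h1 h2 h3 =>
      (hmero.reflQuot_eventuallyEq_normalQuot (hord s h1 h2 h3) (hord' s h3)).eq_of_nhds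
  have hGleft : ∀ s : ℂ, s.re = a → τ' ≤ s.im → ‖G s‖ = 1 := fun s h1 h2 =>
    hmero.norm_normalQuot_eq_one hconj (hord s h1.ge (h1.le.trans ha.le) h2) h1
  -- If `G` were locally ±1 it would be so up to the point σ₀ + iτ', where `hF_ne` forbids it.
  have hnc : ∀ e : ℂ, e = 1 ∨ e = -1 → ∀ s : ℂ, a ≤ s.re → s.re ≤ σ₀ → τ' ≤ s.im →
      ¬ ∀ᶠ z in 𝓝 s, G z = e := by
    intro e he s h1 h2 h3 hcon
    have han : AnalyticOnNhd ℂ G (Set.Icc a σ₀ ×ℂ Set.Ici τ') := fun z hz => by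
      rw [Complex.mem_reProdIm] at hz
      exact hGan z hz.1.1 hz.1.2 hz.2
    have hre : (σ₀ + τ' * Complex.I : ℂ).re = σ₀ := by simp
    have him : (σ₀ + τ' * Complex.I : ℂ).im = τ' := by simp
    have h4 := han.eqOn_of_preconnected_of_eventuallyEq (analyticOnNhd_const (v := e))
      ((convex_Icc a σ₀).isPreconnected_reProdIm (convex_Ici τ'))
      (Complex.mem_reProdIm.2 ⟨⟨h1, h2⟩, h3⟩) hcon
      (show (σ₀ + τ' * Complex.I : ℂ) ∈ Set.Icc a σ₀ ×ℂ Set.Ici τ' by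
        simp [Complex.mem_reProdIm, ha.le])
    rw [← hGF _ (by rw [hre]; exact ha.le) hre.le him.ge] at h4
    rcases he with rfl | rfl
    · exact (hF_ne _ hre).1 h4
    · exact (hF_ne _ hre).2 h4
  have hεe : (-ε : ℂ) = 1 ∨ (-ε : ℂ) = -1 := by
    rcases mul_self_eq_one_iff.1 hε with rfl | rfl <;> simp
  have hordf : ∀ s : ℂ, a ≤ s.re → s.re ≤ σ₀ → τ' ≤ s.im →
      meromorphicOrderAt (reflSum h a ε) s
        = (analyticOrderAt (fun z => G z - -(ε : ℂ)) s).map Nat.cast := by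
    intro s h1 h2 h3
    have hd : AnalyticAt ℂ (fun z => G z - -(ε : ℂ)) s :=
      (hGan s h1 h2 h3).sub analyticAt_const
    rw [hmero.meromorphicOrderAt_reflSum_eq (hord s h1 h2 h3) hεc, hd.meromorphicOrderAt_eq]
  set p : ℂ := a + τ' * Complex.I with hp
  have hpre : p.re = a := by simp [hp]
  have hpim : p.im = τ' := by simp [hp]
  have hGp := hGan p hpre.ge (hpre.le.trans ha.le) hpim.ge
  refine ⟨?_, ?_⟩
  · have hpf : meromorphicOrderAt (reflSum h a ε) p ≠ ⊤ := by
      rw [hordf p hpre.ge (hpre.le.trans ha.le) hpim.ge]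
      intro htop
      refine hnc (-ε) hεe p hpre.ge (hpre.le.trans ha.le) hpim.ge ?_
      have h1 : analyticOrderAt (fun z => G z - -(ε : ℂ)) p = ⊤ := by
        cases h : analyticOrderAt (fun z => G z - -(ε : ℂ)) p with
        | top => rfl
        | coe n =>
          rw [h] at htop
          simp at htop
      filter_upwards [analyticOrderAt_eq_top.1 h1] with z hz using sub_eq_zero.1 hz
    exact (hmero.reflSum a ε).exists_meromorphicOrderAt_ne_top_iff_forall.1 ⟨p, hpf⟩
  have hne : ∀ e : ℂ, e = 1 ∨ e = -1 → ∀ᶠ z in 𝓝[≠] p, G z ≠ e := fun e he =>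
    (hGp.eventually_eq_or_eventually_ne analyticAt_const).resolve_left
      (hnc e he p hpre.ge (hpre.le.trans ha.le) hpim.ge)
  have hvert : Tendsto (fun y : ℝ => (a + y * Complex.I : ℂ)) (𝓝[>] τ') (𝓝[≠] p) := by
    refine tendsto_nhdsWithin_iff.2 ⟨?_, ?_⟩
    · have : Continuous fun y : ℝ => (a + y * Complex.I : ℂ) := by fun_prop
      exact (this.tendsto τ').mono_left nhdsWithin_le_nhds
    · refine eventually_nhdsWithin_of_forall fun y hy hyp => ?_
      have := congrArg Complex.im hyp
      simp [hp] at this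
      exact absurd this hy.ne'
  -- The corner of the half-strip is placed where G ≠ ±1; as |G| = 1 there, `G` is not real at the
  -- corner.
  obtain ⟨τ₁, ⟨hone, hnegone⟩, hτ₁'⟩ := ((hvert.eventually ((hne 1 (Or.inl rfl)).and
    (hne (-1) (Or.inr rfl)))).and self_mem_nhdsWithin).exists
  have hτ₁ : τ' ≤ τ₁ := le_of_lt hτ₁'
  have hb : (G (a + τ₁ * Complex.I)).im ≠ 0 := by
    intro him
    have hnorm := hGleft (a + τ₁ * Complex.I) (by simp) (by simpa using hτ₁)
    obtain ⟨x, hx⟩ : ∃ x : ℝ, G (a + τ₁ * Complex.I) = x :=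
      ⟨_, Complex.ext rfl (by simpa using him)⟩
    rw [hx, Complex.norm_real, Real.norm_eq_abs, abs_eq zero_le_one] at hnorm
    rcases hnorm with rfl | rfl
    · exact hone (by simpa using hx)
    · exact hnegone (by simpa using hx)
  refine ⟨τ₁, (finite_exceptional_of_half_strip ha
    (fun s h1 h2 h3 => hGan s h1 h2 (hτ₁.trans h3))
    (fun s h1 h2 => hGleft s h1 (hτ₁.trans h2))
    (fun s h1 h2 => by
      rw [← hGF s (ha.le.trans h1.ge) h1.le (hτ₁.trans h2)]
      refine (hF_lt s h1 ?_).le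
      rw [habs s (hτ₁.trans h2)]
      linarith) ht
    (fun n s h1 h2 h3 h4 => by
      rw [← hGF s h1 h2 (hτ₁.trans h3)]
      exact (hF_seq n s h1 h2 (by rw [habs s (hτ₁.trans h3), h4])).le)
    hb (e := -ε) (by linarith)).subset ?_⟩
  rintro s ⟨hs, h1, h2, h3, h4⟩
  have h3' := hτ₁.trans h3.le
  have hGs := hGan s h1 h2.le h3'
  have hord_s := hordf s h1 h2.le h3'
  have hs0 : 0 < meromorphicOrderAt (reflSum h a ε) s := hs
  have hval : G s = ((-ε : ℝ) : ℂ) := by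
    rw [hord_s] at hs0
    by_contra hcon
    have h5 : analyticOrderAt (fun z => G z - -(ε : ℂ)) s = 0 := by
      refine (AnalyticAt.analyticOrderAt_eq_zero (hGs.sub analyticAt_const)).2 (sub_ne_zero.2 ?_)
      simpa using hcon
    rw [h5] at hs0
    simp at hs0
  refine ⟨h1, h2, h3, hval, fun hre => ?_⟩
  by_contra hd
  refine h4 ⟨hre, ?_⟩
  have h5 := hGs.analyticOrderAt_sub_eq_one_of_deriv_ne_zero hd
  rw [hval, Complex.ofReal_neg] at h5
  rw [hord_s, h5]
  rfl

/-- If all but finitely many zeros of `f` in a strip lie on its middle line and are simple, the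
number of zeros in the strip, with multiplicity, exceeds the number of distinct zeros on the line by
a bounded amount. -/
theorem exists_stripCount_sub_lineCount_le {f : ℂ → ℂ} {a σ₀ : ℝ} (ha : a < σ₀)
    (hbox : ∀ T : ℝ, 0 < T → (boxZeros f a σ₀ T).Finite)
    (hexc : {s | s ∈ zeroSet f ∧ |s.re - a| < σ₀ - a ∧
      ¬ (s.re = a ∧ meromorphicOrderAt f s = 1)}.Finite) :
    ∃ B : ℝ, ∀ T : ℝ, 0 < T → (stripCount f a σ₀ T : ℝ) - (lineCount f a T : ℝ) ≤ B := by
  classical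
  -- The bound is the total multiplicity of the exceptional zeros; every other zero in the box
  -- counts once on both sides.
  refine ⟨(∑ s ∈ hexc.toFinset, zeroMult f s : ℕ), fun T hT => ?_⟩
  rw [sub_le_iff_le_add]
  norm_cast
  set L : Set ℂ := {s | s ∈ zeroSet f ∧ s.re = a ∧ 0 < s.im ∧ s.im < T} with hL
  have hLbox : L ⊆ boxZeros f a σ₀ T := by
    rintro s ⟨h1, h2, h3⟩
    exact ⟨h1, by simpa [h2] using ha, h3⟩
  have hLfin : L.Finite := (hbox T hT).subset hLbox
  rw [stripCount, finsum_mem_eq_finite_toFinset_sum _ (hbox T hT),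
    ← Finset.sum_filter_add_sum_filter_not _ (· ∈ hexc.toFinset)]
  refine add_le_add ?_ ?_
  · refine Finset.sum_le_sum_of_subset fun s hs => (Finset.mem_filter.1 hs).2
  · have hsimple : ∀ s ∈ (hbox T hT).toFinset.filter (· ∉ hexc.toFinset),
        s ∈ L ∧ zeroMult f s = 1 := by
      intro s hs
      rw [Finset.mem_filter, Set.Finite.mem_toFinset, Set.Finite.mem_toFinset] at hs
      obtain ⟨⟨h1, h2, h3⟩, h4⟩ := hs
      have h5 : s.re = a ∧ meromorphicOrderAt f s = 1 := by
        by_contra h5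
        exact h4 ⟨h1, h2, h5⟩
      exact ⟨⟨h1, h5.1, h3⟩, by rw [zeroMult, h5.2]; rfl⟩
    rw [Finset.sum_congr rfl fun s hs => (hsimple s hs).2, Finset.sum_const, smul_eq_mul, mul_one,
      lineCount, Set.ncard_eq_toFinset_card _ hLfin]
    exact Finset.card_le_card fun s hs => (Set.Finite.mem_toFinset _).2 (hsimple s hs).1

theorem mainTheorem3 (a σ₀ : ℝ) (ha : a < σ₀) (h : ℂ → ℂ)
    (hmero : Meromorphic h)
    (hreal : ∀ x : ℝ, AnalyticAt ℂ h (x : ℂ) → (h (x : ℂ)).im = 0)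
    (hpoles : (poleSet h).Finite)
    (hzeros : {s | s ∈ zeroSet h ∧ a ≤ s.re ∧ s.re < σ₀}.Finite)
    (hline : ∀ s : ℂ, s.re = σ₀ → meromorphicOrderAt h s = 0)
    (hF_ne : ∀ s : ℂ, s.re = σ₀ → reflQuot h a s ≠ 1 ∧ reflQuot h a s ≠ -1)
    (hF_lt : ∃ τ₀ : ℝ, 0 < τ₀ ∧ ∀ s : ℂ, s.re = σ₀ → τ₀ ≤ |s.im| →
      AnalyticAt ℂ (reflQuot h a) s ∧ ‖reflQuot h a s‖ < 1)
    (hF_seq : ∃ K : ℝ, 0 < K ∧ ∃ t : ℕ → ℝ, Tendsto t atTop atTop ∧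
      ∀ n : ℕ, ∀ s : ℂ, a ≤ s.re → s.re ≤ σ₀ → |s.im| = t n →
        AnalyticAt ℂ (reflQuot h a) s ∧ ‖reflQuot h a s‖ < Real.exp (K * ‖s‖))
    (ε : ℂ) (hε : ε = 1 ∨ ε = -1) :
    (∀ T : ℝ, 0 < T → (boxZeros (reflSum h a ε) a σ₀ T).Finite) ∧
    (∃ B : ℝ, ∀ T : ℝ, 0 < T →
      (stripCount (reflSum h a ε) a σ₀ T : ℝ) - (lineCount (reflSum h a ε) a T : ℝ) ≤ B) ∧
    {s | s ∈ zeroSet (reflSum h a ε) ∧ |s.re - a| < σ₀ - a ∧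
      ¬ (s.re = a ∧ meromorphicOrderAt (reflSum h a ε) s = 1)}.Finite := by

  obtain ⟨τ₀, -, hτ₀⟩ := hF_lt
  obtain ⟨K, -, t, ht, hK⟩ := hF_seq
  obtain ⟨r, hr, rfl⟩ : ∃ r : ℝ, r * r = 1 ∧ ε = r := by
    rcases hε with rfl | rfl
    · exact ⟨1, by norm_num, by simp⟩
    · exact ⟨-1, by norm_num, by simp⟩
  have hrc : (r : ℂ) * r = 1 := by exact_mod_cast hr
  have hconj := hmero.conjRefl_eventuallyEq hreal
  obtain ⟨htop, τ₁, hfin⟩ := exists_finite_exceptional_zeros ha hmero hconj hpoles hzeros hline hF_ne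
    (fun s h1 h2 => (hτ₀ s h1 h2).2) ht (fun n s h1 h2 h3 => (hK n s h1 h2 h3).2) hr
  set f := reflSum h a r with hf
  have hfm : Meromorphic f := hmero.reflSum a r
  have hbounded : ∀ T : ℝ, {s | s ∈ zeroSet f ∧ |s.re - a| < σ₀ - a ∧ |s.im| ≤ T}.Finite := by
    intro T
    refine (hfm.finite_zeroSet_inter htop (R := Set.Icc (2 * a - σ₀) σ₀ ×ℂ Set.Icc (-T) T)
      (isCompact_Icc.reProdIm isCompact_Icc)).subset ?_
    rintro s ⟨h1, h2, h3⟩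
    rw [abs_lt] at h2
    rw [abs_le] at h3
    exact ⟨h1, Complex.mem_reProdIm.2 ⟨⟨by linarith, by linarith⟩, h3⟩⟩
  have hbox : ∀ T : ℝ, 0 < T → (boxZeros f a σ₀ T).Finite := fun T _ =>
    (hbounded T).subset fun s hs => ⟨hs.1, hs.2.1, (abs_of_pos hs.2.2.1).le.trans hs.2.2.2.le⟩
  have hordconj : ∀ s, meromorphicOrderAt f (starRingEnd ℂ s) = meromorphicOrderAt f s :=
    hfm.meromorphicOrderAt_conj (conjRefl_reflSum_eventuallyEq hconj a (Complex.conj_ofReal r))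
  have hordsub : ∀ s, meromorphicOrderAt f (2 * a - s) = meromorphicOrderAt f s := fun s =>
    meromorphicOrderAt_reflSum_const_sub hrc
  have hexc : {s | s ∈ zeroSet f ∧ |s.re - a| < σ₀ - a ∧
      ¬ (s.re = a ∧ meromorphicOrderAt f s = 1)}.Finite := by
    set E := {s | s ∈ zeroSet f ∧ a ≤ s.re ∧ s.re < σ₀ ∧ τ₁ < s.im ∧
      ¬ (s.re = a ∧ meromorphicOrderAt f s = 1)} with hE
    have hinj₁ : Function.Injective (starRingEnd ℂ) := (starRingEnd ℂ).injective
    have hinj₂ : Function.Injective fun s : ℂ => 2 * (a : ℂ) - s := sub_right_injective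
    -- Low zeros are finite in number by compactness. Every other exceptional zero is moved into the
    -- upper right quarter of the strip by the identity, by conjugation, by s ↦ 2a - s, or by the
    -- composite of the last two.
    refine ((((hbounded τ₁).union hfin).union (hfin.preimage hinj₁.injOn)).union
      ((hfin.preimage hinj₂.injOn).union
        (hfin.preimage (hinj₂.comp hinj₁).injOn))).subset ?_
    rintro s ⟨h1, h2, h3⟩
    have h1' : 0 < meromorphicOrderAt f s := h1
    obtain ⟨h4, h5⟩ := abs_lt.1 h2
    rcases le_or_gt |s.im| τ₁ with h6 | h6
    · exact Or.inl (Or.inl (Or.inl ⟨h1, h2, h6⟩))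
    · rcases le_or_gt a s.re with h7 | h7 <;> rcases lt_abs.1 h6 with h8 | h8
      · exact Or.inl (Or.inl (Or.inr ⟨h1, h7, by linarith, h8, h3⟩))
      · refine Or.inl (Or.inr ⟨?_, by simpa using h7, by simpa using (by linarith : s.re < σ₀),
          by simpa using h8, ?_⟩)
        · change 0 < meromorphicOrderAt f _
          rwa [hordconj]
        · rwa [hordconj, Complex.conj_re]
      · have hre : (2 * (a : ℂ) - starRingEnd ℂ s).re = 2 * a - s.re := by simp
        have him : (2 * (a : ℂ) - starRingEnd ℂ s).im = s.im := by simp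
        refine Or.inr (Or.inr ⟨?_, ?_, ?_, ?_, ?_⟩) <;> simp only [Function.comp]
        · change 0 < meromorphicOrderAt f _
          rwa [hordsub, hordconj]
        · rw [hre]; linarith
        · rw [hre]; linarith
        · rwa [him]
        · rw [hre]
          exact fun h => h7.ne (by linarith [h.1])
      · have hre : (2 * (a : ℂ) - s).re = 2 * a - s.re := by simp
        have him : (2 * (a : ℂ) - s).im = -s.im := by simp
        refine Or.inr (Or.inl ⟨?_, ?_, ?_, ?_, ?_⟩)
        · change 0 < meromorphicOrderAt f _
          rwa [hordsub]
        · rw [hre]; linarith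
        · rw [hre]; linarith
        · rwa [him]
        · rw [hre]
          exact fun h => h7.ne (by linarith [h.1])
  exact ⟨hbox, exists_stripCount_sub_lineCount_le ha hbox hexc, hexc⟩
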